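/- All graphs are finite and simple. Let $\alpha>0$ be a real number, let $k$ and $\ell\ge 2$ be positive integers, and let $H$ be a graph with $k$ vertices and $\ell$ edges such that $m(H)\le \alpha k$, where $m(H)$ denotes the number of non-isolated vertices of $H$. Then $$\mathrm{ind}(H)\;\le\;\frac{2+3e^2\alpha}{2+(e-2)\,\nu(H)}\cdot\frac1e+2\alpha .$$ Here the following notation is used. - For a graph $G$ on $n\ge k$ vertices, the induced density of $H$ in $G$ is the probability that a uniformly random set $W$ of $k$ vertices of $G$ satisfies $G[W]\cong H$. The inducibility $\mathrm{ind}(H)$ is the limit, as $n\to\infty$, of the maximum of the induced density of $H$ over all $n$-vertex graphs $G$ (this limit exists). - For a graph $F$, $M(F)$ denotes the induced subgraph of $F$ on its non-isolated vertices. A non-isolated vertex $v$ of $H$ is *obscure* in $H$ if there are distinct non-isolated vertices $v_1,v_2$ of $H$ such that $v_2$ has positive degree in $H-v_1$ and $M(H-v)$ is isomorphic to some induced subgraph of $H-v_1-v_2$. A non-isolated vertex of $H$ is *detectable* in $H$ if it is not obscure in $H$. - A labelling $v_1,\dots,v_k$ of the vertex set of $H$ is *bright* if there are at least two indices $i\in\{1,\dots,k\}$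 such that $v_i$ has at least one neighbour in $\{v_1,\dots,v_i\}$, and the two largest such indices $i_1<i_2$ are such that $v_{i_1}$ and $v_{i_2}$ are both detectable in $H$. Finally, $\nu(H)$ is the probability that a uniformly random labelling $v_1,\dots,v_k$ of the vertex set of $H$ is bright. -/

import Mathlib

open Filter Topology

noncomputable section

namespace SimpleGraph

variable {V U : Type*}

/-- The number of `|V|`-element vertex sets `W` of `G` with `G[W] ≅ H`. -/
def inducedCount [Fintype V] [Fintype U] (H : SimpleGraph V) (G : SimpleGraph U) : ℕ :=
  Nat.card {W : Finset U // W.card = Fintype.card V ∧ Nonempty (G.induce (W : Set U) ≃g H)}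

/-- The induced density of `H` in `G`: the probability that a uniformly random `|V|`-element vertex
set `W` of `G` satisfies `G[W] ≅ H`. -/
def inducedDensity [Fintype V] [Fintype U] (H : SimpleGraph V) (G : SimpleGraph U) : ℝ :=
  (inducedCount H G : ℝ) / ((Fintype.card U).choose (Fintype.card V) : ℝ)

/-- The maximum of the induced density of `H` over all graphs on `n` vertices. -/
def maxInducedDensity [Fintype V] (H : SimpleGraph V) (n : ℕ) : ℝ :=
  ⨆ G : SimpleGraph (Fin n), inducedDensity H G

/-- The inducibility of `H`: the limit of the maximum induced density of `H` over `n`-vertex graphs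
as `n → ∞`. The limit exists by `tendsto_inducibility`. -/
def inducibility [Fintype V] (H : SimpleGraph V) : ℝ :=
  limUnder atTop (maxInducedDensity H)

lemma inducedDensity_nonneg [Fintype V] [Fintype U] (H : SimpleGraph V) (G : SimpleGraph U) :
    0 ≤ inducedDensity H G := by
  unfold inducedDensity; positivity

lemma inducedDensity_le_max [Fintype V] (H : SimpleGraph V) {n : ℕ} (G : SimpleGraph (Fin n)) :
    inducedDensity H G ≤ maxInducedDensity H n :=
  le_ciSup (f := fun G : SimpleGraph (Fin n) => inducedDensity H G)
    (Set.finite_range _).bddAbove G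

lemma maxInducedDensity_nonneg [Fintype V] (H : SimpleGraph V) (n : ℕ) :
    0 ≤ maxInducedDensity H n :=
  (inducedDensity_nonneg H ⊥).trans (inducedDensity_le_max H ⊥)

/-- Deleting one vertex at a time counts every induced copy of `H` exactly `n + 1 - |V|` times. -/
lemma inducedCount_mul_le_sum [Fintype V] (H : SimpleGraph V) {n : ℕ}
    (G : SimpleGraph (Fin (n + 1))) :
    inducedCount H G * (n + 1 - Fintype.card V) ≤
      ∑ v : Fin (n + 1), inducedCount H (G.comap v.succAboveEmb) := by
  classical
  set P := {W : Finset (Fin (n + 1)) // W.card = Fintype.card V ∧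
    Nonempty (G.induce (W : Set (Fin (n + 1))) ≃g H)} with hP
  have key : ∀ v : Fin (n + 1),
      Fintype.card {W : P // v ∉ W.1} ≤ inducedCount H (G.comap v.succAboveEmb) := by
    intro v
    unfold inducedCount
    rw [← Nat.card_eq_fintype_card]
    have himg : ∀ W : {W : P // v ∉ W.1},
        (W.1.1.preimage v.succAboveEmb v.succAboveEmb.injective.injOn).map v.succAboveEmb
          = W.1.1 := by
      rintro ⟨⟨W, hW⟩, hv⟩
      rw [Finset.map_eq_image, Finset.image_preimage]
      refine Finset.filter_true_of_mem fun x hx => ?_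
      have hxv : x ≠ v := fun h => hv (h ▸ hx)
      obtain ⟨y, hy⟩ := Fin.exists_succAbove_eq hxv
      exact ⟨y, hy⟩
    refine Nat.card_le_card_of_injective
      (fun W => ⟨W.1.1.preimage v.succAboveEmb v.succAboveEmb.injective.injOn, ?_, ?_⟩) ?_
    · rw [← Finset.card_map v.succAboveEmb, himg W]
      exact W.1.2.1
    · obtain ⟨e⟩ := W.1.2.2
      have hmem : ∀ x : Fin n,
          x ∈ W.1.1.preimage v.succAboveEmb v.succAboveEmb.injective.injOn ↔
            v.succAboveEmb x ∈ W.1.1 := fun x => Finset.mem_preimage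
      let f : {x : Fin n // x ∈ (W.1.1.preimage v.succAboveEmb v.succAboveEmb.injective.injOn :
          Set (Fin n))} → {x : Fin (n + 1) // x ∈ (W.1.1 : Set (Fin (n + 1)))} :=
        fun x => ⟨v.succAboveEmb x.1, (hmem x.1).1 x.2⟩
      have hf : Function.Bijective f := by
        refine ⟨fun x y h => Subtype.ext (v.succAboveEmb.injective (congrArg Subtype.val h)), ?_⟩
        rintro ⟨y, hy⟩
        have hyv : y ≠ v := fun h => W.2 (h ▸ hy)
        obtain ⟨x, hx⟩ := Fin.exists_succAbove_eq hyv
        exact ⟨⟨x, (hmem x).2 (by rw [Fin.succAboveEmb_apply, hx]; exact hy)⟩, Subtype.ext hx⟩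
      exact ⟨RelIso.trans ⟨Equiv.ofBijective f hf, Iff.rfl⟩ e⟩
    · intro W₁ W₂ h
      have h' := congrArg (fun X => X.1.map v.succAboveEmb) h
      simp only [himg] at h'
      exact Subtype.ext (Subtype.ext h')
  calc inducedCount H G * (n + 1 - Fintype.card V)
      = ∑ W : P, (n + 1 - Fintype.card V) := by
        simp [inducedCount, hP, Nat.card_eq_fintype_card]
    _ = ∑ W : P, (Finset.univ.filter fun v => v ∉ W.1).card := by
        refine Finset.sum_congr rfl fun W _ => ?_
        have : (Finset.univ.filter fun v => v ∉ W.1) = W.1ᶜ := by ext; simp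
        rw [this, Finset.card_compl, W.2.1, Fintype.card_fin]
    _ = ∑ v : Fin (n + 1), (Finset.univ.filter fun W : P => v ∉ W.1).card := by
        simp only [Finset.card_filter]
        exact Finset.sum_comm
    _ ≤ _ := Finset.sum_le_sum fun v _ => by
        rw [← Fintype.card_subtype]; exact key v

lemma maxInducedDensity_succ_le [Fintype V] (H : SimpleGraph V) {n : ℕ}
    (hn : Fintype.card V ≤ n) : maxInducedDensity H (n + 1) ≤ maxInducedDensity H n := by
  refine ciSup_le fun G => ?_
  set k := Fintype.card V with hk
  have hc : (0 : ℝ) < (n.choose k : ℝ) := by exact_mod_cast Nat.choose_pos hn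
  have hc' : (0 : ℝ) < ((n + 1).choose k : ℝ) := by
    exact_mod_cast Nat.choose_pos (hn.trans n.le_succ)
  have h1 : (inducedCount H G : ℝ) * ((n + 1 - k : ℕ) : ℝ) ≤
      ∑ v : Fin (n + 1), (inducedCount H (G.comap v.succAboveEmb) : ℝ) := by
    exact_mod_cast inducedCount_mul_le_sum H G
  have h2 : ∀ v : Fin (n + 1), (inducedCount H (G.comap v.succAboveEmb) : ℝ) ≤
      maxInducedDensity H n * n.choose k := by
    intro v
    have := inducedDensity_le_max H (G.comap v.succAboveEmb)
    rwa [inducedDensity, Fintype.card_fin, div_le_iff₀ hc] at this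
  have h3 := h1.trans (Finset.sum_le_sum fun v _ => h2 v)
  rw [Finset.sum_const, Finset.card_univ, Fintype.card_fin, nsmul_eq_mul] at h3
  have h4 : (n.choose k : ℝ) * ((n + 1 : ℕ) : ℝ) =
      ((n + 1).choose k : ℝ) * ((n + 1 - k : ℕ) : ℝ) := by
    exact_mod_cast Nat.choose_mul_succ_eq n k
  have hpos : (0 : ℝ) < ((n + 1 - k : ℕ) : ℝ) := by
    exact_mod_cast (by omega : 0 < n + 1 - k)
  rw [inducedDensity, Fintype.card_fin, div_le_iff₀ hc']
  refine le_of_mul_le_mul_right (h3.trans (le_of_eq ?_)) hpos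
  linear_combination maxInducedDensity H n * h4

/-- The limit defining the inducibility exists. -/
theorem tendsto_inducibility [Fintype V] (H : SimpleGraph V) :
    Tendsto (maxInducedDensity H) atTop (𝓝 (inducibility H)) := by
  have hanti : Antitone fun n => maxInducedDensity H (n + Fintype.card V) :=
    antitone_nat_of_succ_le fun n => by
      rw [show n + 1 + Fintype.card V = n + Fintype.card V + 1 by omega]
      exact maxInducedDensity_succ_le H (Nat.le_add_left _ _)
  have hbdd : BddBelow (Set.range fun n => maxInducedDensity H (n + Fintype.card V)) :=
    ⟨0, by rintro _ ⟨n, rfl⟩; exact maxInducedDensity_nonneg H _⟩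
  have h := (tendsto_add_atTop_iff_nat (Fintype.card V)).1 (tendsto_atTop_ciInf hanti hbdd)
  exact tendsto_nhds_limUnder ⟨_, h⟩

/-- `m(H)`: the number of non-isolated vertices of `H`. -/
def numNonIsolated (H : SimpleGraph V) : ℕ :=
  {v : V | ¬ H.IsIsolated v}.ncard

/-- `M(H)`: the induced subgraph of `H` on its non-isolated vertices. -/
def nonIsolatedPart (H : SimpleGraph V) : SimpleGraph {v : V | ¬ H.IsIsolated v} :=
  H.induce {v : V | ¬ H.IsIsolated v}

/-- The degree of `v` into `W`: the number of neighbours of `v` in `W`. -/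
def degreeInto (H : SimpleGraph V) (W : Set V) (v : V) : ℕ :=
  (H.neighborSet v ∩ W).ncard

/-- A non-isolated vertex `v` is obscure in `H` if there are distinct non-isolated vertices `v₁, v₂`
such that `v₂` has positive degree in `H - v₁` and `M(H - v)` is isomorphic to an induced subgraph
of `H - v₁ - v₂`. -/
def IsObscure (H : SimpleGraph V) (v : V) : Prop :=
  ¬ H.IsIsolated v ∧ ∃ v₁ v₂ : V, v₁ ≠ v₂ ∧ ¬ H.IsIsolated v₁ ∧ ¬ H.IsIsolated v₂ ∧
    0 < H.degreeInto {v₁}ᶜ v₂ ∧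
    (H.induce {v}ᶜ).nonIsolatedPart.IsIndContained (H.induce {v₁, v₂}ᶜ)

/-- A non-isolated vertex is detectable if it is not obscure. -/
def IsDetectable (H : SimpleGraph V) (v : V) : Prop :=
  ¬ H.IsIsolated v ∧ ¬ H.IsObscure v

/-- The `i`-th vertex of the labelling `σ` has a neighbour among the first `i` vertices. -/
def IsBackAttached (H : SimpleGraph V) {k : ℕ} (σ : Fin k ≃ V) (i : Fin k) : Prop :=
  0 < H.degreeInto (σ '' Set.Iic i) (σ i)

/-- A labelling `σ 0, …, σ (k - 1)` of the vertices of `H` is bright if there are at least two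
indices `i` such that `σ i` has a neighbour among `σ 0, …, σ i`, and the vertices at the two largest
such indices `i₁ < i₂` are detectable in `H`. -/
def IsBright (H : SimpleGraph V) {k : ℕ} (σ : Fin k ≃ V) : Prop :=
  ∃ i₁ i₂ : Fin k, i₁ < i₂ ∧ H.IsBackAttached σ i₁ ∧ H.IsBackAttached σ i₂ ∧
    (∀ j, H.IsBackAttached σ j → j ≤ i₁ ∨ j = i₂) ∧
    H.IsDetectable (σ i₁) ∧ H.IsDetectable (σ i₂)

/-- `ν(H)`: the probability that a uniformly random labelling of the vertices of `H` is bright. -/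
def brightness [Fintype V] (H : SimpleGraph V) : ℝ :=
  (Nat.card {σ : Fin (Fintype.card V) ≃ V // H.IsBright σ} : ℝ) /
    (Nat.card (Fin (Fintype.card V) ≃ V) : ℝ)

end SimpleGraph

end

/-!
Draw vertices of a finite graph `G` independently and uniformly, one after another. A new vertex
*meets* the set `X` of the earlier ones if it belongs to `X` or has a neighbour in `X`. The core of
`X`, the set of non-isolated vertices of `G[X]`, changes only when a new vertex meets `X`. Call `X`
*full* if its core induces a copy of `M(H)`, and *critical* if its core induces a copy of `M(H - v)`
for some detectable `v`.

A sequence of `|V(H)|` draws that runs through an induced copy of `H` yields a labelling of `H`, and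
its back-attached indices are the times at which the drawn vertex meets the earlier ones. Pay `e`
for such a sequence if the labelling is not bright and `e ^ 2 / 2` if it is; these are the
reciprocals of the maxima of the Poisson probabilities `x * exp (-x)` and `x ^ 2 / 2 * exp (-x)`.
The core of the proof is that the expected payment is at most `1` (`rewardMean_le_one`). To be exact,
nothing is paid when a vertex that meets the earlier ones comes too late, or when the last two of
them come directly after one another. Only a fraction of order `α` of the labellings of `H` is lost
in this way.

The payment is described by the states full and critical alone. From a set that is neither, a
meeting vertex either makes the set full (payment `e` if nothing is met later on), or makes it
critical, or leads to a third kind of set, from which one goes on as before. By detectability a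
critical set is completed by exactly one further meeting vertex (`not_isCritical_of_meets`). If that
vertex would have met the set and made it critical also without the previous one, then the labelling
is bright; otherwise it is not (`selfReward_last_two`).

The bound on the expected payment is a backward induction on the number of remaining draws
(`potential_le`). The idea is to *delay* the vertices that meet: along a sequence of vertices that
meet nothing one records the measure `lam` of the vertices that could have been inserted so as to
make the set full, and a measure `m` of total mass `γ` on the vertices that could have been inserted
so as to make it critical. The potential adds to the expected payment the payment for the inserted
vertices: `e * lam` for a single one, `e ^ 2 / 4 * γ ^ 2` for two, and for each single vertex of `m`
what can still be earned with it. It is at most `exp (lam + γ)`. For the step, let `d`, `c`, `ρ` be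
the probabilities that the next vertex makes the set full, critical, or neither though it meets the
set. If it meets nothing, then `lam + γ` becomes at most `lam + γ + d + c`. In the case of
probability `ρ` the potential starts afresh with `γ + c` in the role of `lam`, because an inserted
vertex can now at best complete the copy. The step is therefore
`(1 - d - c - ρ) * exp (d + c) + ρ * exp (d + c) ≤ 1`. When two draws are left, nothing more can be
earned, and the claim is `e * lam + e ^ 2 / 4 * γ ^ 2 ≤ exp (lam + γ)` (`exp_one_mul_add_sq_le`).

Averaging over the labellings of `H` turns the bound into
`ind(H) * (e * (1 - ν - 2 * α) + e ^ 2 / 2 * (ν - 2 * α)) ≤ 1` (`inducibility_mul_le`), which gives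
the theorem.
-/

noncomputable section

namespace SimpleGraph

/-! ### Exploring a graph by random vertices -/

section Exploration

open scoped Classical

variable {U : Type*}

/-- `u` meets `X` if it belongs to `X` or has a neighbour in `X`. Repetitions count as meeting, since the
vertices are drawn with replacement. -/
def Meets (G : SimpleGraph U) (X : Finset U) (u : U) : Prop :=
  u ∈ X ∨ ∃ x ∈ X, G.Adj x u

lemma Meets.mono {G : SimpleGraph U} {X Y : Finset U} (h : X ⊆ Y) {u : U} (hu : G.Meets X u) :
    G.Meets Y u := by
  rcases hu with hu | ⟨x, hx, hxu⟩
  · exact Or.inl (h hu)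
  · exact Or.inr ⟨x, h hx, hxu⟩

/-- No vertex of the list meets the union of `X` and the vertices before it. -/
def Quiet (G : SimpleGraph U) : Finset U → List U → Prop
  | _, [] => True
  | X, u :: l => ¬ G.Meets X u ∧ Quiet G (insert u X) l

lemma Quiet.anti {G : SimpleGraph U} {l : List U} : ∀ {X Y : Finset U}, X ⊆ Y → G.Quiet Y l →
    G.Quiet X l := by
  induction l with
  | nil => intro X Y _ _; trivial
  | cons u l ih =>
    intro X Y h hY
    exact ⟨fun hu => hY.1 (hu.mono h), ih (Finset.insert_subset_insert u h) hY.2⟩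

/-- The payment for the remaining draws `l` when a vertex `w` has made the set critical and `X` is the
set of all other vertices drawn so far. It is decided by the next vertex `u` that meets
`insert w X`. The flag `b` records that `w` is the most recent draw; in this case the higher payment
is withheld. -/
def pairReward (G : SimpleGraph U) (P Q : Finset U → Prop) :
    Bool → U → Finset U → List U → ℝ
  | _, _, _, [] => 0
  | b, w, X, u :: l =>
    if ¬ G.Meets (insert w X) u then pairReward G P Q false w (insert u X) l
    else if ¬ P (insert u (insert w X)) ∨ P (insert u X) then 0
    else if G.Meets X u ∧ Q (insert u X) then
      if b = false ∧ 1 ≤ l.length ∧ G.Quiet (insert u (insert w X)) l then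
        Real.exp 1 ^ 2 / 2 else 0
    else if 2 ≤ l.length ∧ G.Quiet (insert u (insert w X)) l then Real.exp 1 else 0

/-- The payment for the remaining draws when `X` is the set of the vertices drawn so far. Here `P` and
`Q` stand for the properties of being full and being critical. A set made full is paid `e` if at
least two draws remain and none of them meets the earlier vertices. -/
def reward (G : SimpleGraph U) (P Q : Finset U → Prop) : Finset U → List U → ℝ
  | _, [] => 0
  | X, u :: l =>
    if ¬ G.Meets X u then reward G P Q (insert u X) l
    else if P (insert u X) then
      if 2 ≤ l.length ∧ G.Quiet (insert u X) l then Real.exp 1 else 0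
    else if Q (insert u X) then pairReward G P Q true u X l
    else reward G P Q (insert u X) l

lemma pairReward_nonneg (G : SimpleGraph U) (P Q : Finset U → Prop) (l : List U) :
    ∀ (b : Bool) (w : U) (X : Finset U), 0 ≤ pairReward G P Q b w X l := by
  induction l with
  | nil => intro b w X; simp [pairReward]
  | cons u l ih =>
    intro b w X
    simp only [pairReward]
    split_ifs <;> first | exact ih _ _ _ | positivity

lemma reward_nonneg (G : SimpleGraph U) (P Q : Finset U → Prop) (l : List U) :
    ∀ X : Finset U, 0 ≤ reward G P Q X l := by
  induction l with
  | nil => intro X; simp [reward]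
  | cons u l ih =>
    intro X
    simp only [reward]
    split_ifs <;> first | exact ih _ | exact pairReward_nonneg G P Q _ _ _ _ | positivity

variable [Fintype U]

/-- The mean of `F` over all lists of `r` independent uniform elements of `U`. -/
def mean : (r : ℕ) → (List U → ℝ) → ℝ
  | 0, F => F []
  | r + 1, F => (∑ u, mean r fun l => F (u :: l)) / Fintype.card U

lemma mean_mono {r : ℕ} : ∀ {F F' : List U → ℝ}, (∀ l, l.length = r → F l ≤ F' l) →
    mean r F ≤ mean r F' := by
  induction r with
  | zero => intro F F' h; exact h [] rfl
  | succ r ih =>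
    intro F F' h
    simp only [mean]
    gcongr with u
    exact ih fun l hl => h _ (by simp [hl])

lemma mean_congr {r : ℕ} {F F' : List U → ℝ} (h : ∀ l, l.length = r → F l = F' l) :
    mean r F = mean r F' :=
  le_antisymm (mean_mono fun l hl => (h l hl).le) (mean_mono fun l hl => (h l hl).ge)

lemma mean_mul_left {r : ℕ} (a : ℝ) : ∀ (F : List U → ℝ),
    mean r (fun l => a * F l) = a * mean r F := by
  induction r with
  | zero => intro F; rfl
  | succ r ih =>
    intro F
    simp only [mean, ih fun l => F (_ :: l)]
    rw [← Finset.mul_sum, mul_div_assoc]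

lemma mean_const [Nonempty U] (r : ℕ) (a : ℝ) : mean r (fun _ : List U => a) = a := by
  induction r with
  | zero => rfl
  | succ r ih =>
    simp only [mean, ih]
    simp

lemma mean_eq_sum (r : ℕ) : ∀ F : List U → ℝ,
    mean r F = (∑ f : Fin r → U, F (List.ofFn f)) / (Fintype.card U : ℝ) ^ r := by
  induction r with
  | zero => intro F; simp [mean]
  | succ r ih =>
    intro F
    simp only [mean, ih]
    rw [← Finset.sum_div, div_div, ← pow_succ,
      ← (Fin.consEquiv fun _ => U).sum_comp, Fintype.sum_prod_type]
    simp [Fin.consEquiv]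

/-- The probability that none of `r` draws meets the union of `X` and the earlier draws. -/
def quietProb (G : SimpleGraph U) (r : ℕ) (X : Finset U) : ℝ :=
  mean r fun l => if G.Quiet X l then 1 else 0

variable (G : SimpleGraph U) (P Q : Finset U → Prop)

lemma quietProb_zero (X : Finset U) : quietProb G 0 X = 1 := by
  simp [quietProb, mean, Quiet]

lemma quietProb_succ (r : ℕ) (X : Finset U) : quietProb G (r + 1) X =
    (∑ u, if G.Meets X u then 0 else quietProb G r (insert u X)) / Fintype.card U := by
  simp only [quietProb, mean, Quiet]
  congr 1
  refine Finset.sum_congr rfl fun u _ => ?_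
  split_ifs with h
  · simp only [h, not_true, false_and, if_false]
    simpa using mean_mul_left (U := U) (r := r) 0 fun _ => 0
  · simp only [h, not_false_iff, true_and]

lemma quietProb_nonneg (r : ℕ) : ∀ X : Finset U, 0 ≤ quietProb G r X := by
  induction r with
  | zero => intro X; simp [quietProb_zero]
  | succ r ih =>
    intro X
    rw [quietProb_succ]
    refine div_nonneg (Finset.sum_nonneg fun u _ => ?_) (Nat.cast_nonneg _)
    split_ifs
    exacts [le_rfl, ih _]

lemma quietProb_anti (r : ℕ) {X Y : Finset U} (h : X ⊆ Y) :
    quietProb G r Y ≤ quietProb G r X := by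
  refine mean_mono fun l _ => ?_
  by_cases hY : G.Quiet Y l
  · simp [hY, hY.anti h]
  · simp only [hY, if_false]; split_ifs <;> norm_num

lemma quietProb_le_one [Nonempty U] (r : ℕ) (X : Finset U) : quietProb G r X ≤ 1 := by
  calc quietProb G r X ≤ mean r (fun _ : List U => (1 : ℝ)) :=
        mean_mono fun l _ => by split_ifs <;> norm_num
    _ = 1 := mean_const r 1

lemma mean_quiet {r : ℕ} (X : Finset U) (a : ℝ) (p : Prop) [Decidable p] (F : List U → ℝ)
    (h : ∀ l, l.length = r → F l = if p ∧ G.Quiet X l then a else 0) :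
    mean r F = if p then a * quietProb G r X else 0 := by
  split_ifs with hp
  · rw [quietProb, ← mean_mul_left]
    refine mean_congr fun l hl => ?_
    simp [h l hl, hp]
  · rw [mean_congr (F' := fun _ => 0 * (0 : ℝ)) fun l hl => by simp [h l hl, hp], mean_mul_left]
    simp

/-- The expected value of `pairReward` over `r` draws. -/
def pairMean (b : Bool) (r : ℕ) (w : U) (X : Finset U) : ℝ :=
  mean r (pairReward G P Q b w X)

/-- The expected value of `reward` over `r` draws. -/
def rewardMean (r : ℕ) (X : Finset U) : ℝ :=
  mean r (reward G P Q X)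

/-- The value of `pairMean` with `r + 1` draws, conditional on the first of them being `u`. -/
def pairStep (b : Bool) (r : ℕ) (w : U) (X : Finset U) (u : U) : ℝ :=
  if ¬ G.Meets (insert w X) u then pairMean G P Q false r w (insert u X)
  else if ¬ P (insert u (insert w X)) ∨ P (insert u X) then 0
  else if G.Meets X u ∧ Q (insert u X) then
    if b = false ∧ 1 ≤ r then Real.exp 1 ^ 2 / 2 * quietProb G r (insert u (insert w X)) else 0
  else if 2 ≤ r then Real.exp 1 * quietProb G r (insert u (insert w X)) else 0

lemma pairMean_succ (b : Bool) (r : ℕ) (w : U) (X : Finset U) : pairMean G P Q b (r + 1) w X =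
    (∑ u, pairStep G P Q b r w X u) / Fintype.card U := by
  unfold pairMean pairStep
  simp only [mean, pairReward]
  congr 1
  refine Finset.sum_congr rfl fun u _ => ?_
  by_cases h1 : G.Meets (insert w X) u
  · by_cases h2 : ¬ P (insert u (insert w X)) ∨ P (insert u X)
    · simp only [h1, h2, not_true, if_true, if_false]
      simpa using mean_mul_left (U := U) (r := r) 0 fun _ => 0
    · by_cases h3 : G.Meets X u ∧ Q (insert u X)
      · simp only [h1, h2, h3, and_self, not_true, if_true, if_false]
        exact mean_quiet G _ _ _ _ fun l hl => by simp only [hl, and_assoc]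
      · simp only [h1, h2, h3, not_true, if_false]
        exact mean_quiet G _ _ _ _ fun l hl => by simp only [hl]
  · simp only [h1, not_false_iff, if_true]
    rfl

lemma rewardMean_succ (r : ℕ) (X : Finset U) : rewardMean G P Q (r + 1) X =
    (∑ u, if ¬ G.Meets X u then rewardMean G P Q r (insert u X)
      else if P (insert u X) then if 2 ≤ r then Real.exp 1 * quietProb G r (insert u X) else 0
      else if Q (insert u X) then pairMean G P Q true r u X
      else rewardMean G P Q r (insert u X)) / Fintype.card U := by
  unfold rewardMean pairMean
  simp only [mean, reward]
  congr 1
  refine Finset.sum_congr rfl fun u _ => ?_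
  by_cases h1 : G.Meets X u
  · by_cases h2 : P (insert u X)
    · simp only [h1, h2, not_true, if_true, if_false]
      exact mean_quiet G _ _ _ _ fun l hl => by simp only [hl]
    · by_cases h3 : Q (insert u X) <;> simp only [h1, h2, h3, not_true, if_true, if_false]
  · simp only [h1, not_false_iff, if_true]

end Exploration

/-! ### The potential and its one-step inequality -/

section Exploration

open scoped Classical

variable {U : Type*}

/-- Equality holds at `(x, y) = (1, 0)` and `(x, y) = (0, 2)`, the maxima of the Poisson probabilities
of the values one and two. -/
lemma exp_one_mul_add_sq_le {x y : ℝ} (hx : 0 ≤ x) (hy : 0 ≤ y) :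
    Real.exp 1 * x + Real.exp 1 ^ 2 / 4 * y ^ 2 ≤ Real.exp (x + y) := by
  have hlin : ∀ t : ℝ, Real.exp 1 * t ≤ Real.exp t := fun t => by
    have h := Real.add_one_le_exp (t - 1)
    have h2 : Real.exp t = Real.exp 1 * Real.exp (t - 1) := by rw [← Real.exp_add]; ring_nf
    rw [h2]
    exact mul_le_mul_of_nonneg_left (by linarith) (Real.exp_pos 1).le
  have he : 0 < Real.exp 1 := Real.exp_pos 1
  rcases le_or_gt (Real.exp 1 * y) 4 with h | h
  · have h1 := hlin (x + y)
    nlinarith [mul_nonneg he.le hy]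
  · have h1 : Real.exp 1 ^ 2 / 4 * y ^ 2 ≤ Real.exp y := by
      have h2 := hlin (y / 2)
      have h3 : Real.exp y = Real.exp (y / 2) ^ 2 := by rw [← Real.exp_nat_mul]; ring_nf
      rw [h3]
      have h4 : 0 ≤ Real.exp 1 * (y / 2) := by positivity
      nlinarith
    have h5 : Real.exp 1 ≤ Real.exp y := by
      apply Real.exp_le_exp.2
      have := Real.exp_one_lt_d9
      nlinarith
    have h6 := Real.add_one_le_exp x
    rw [Real.exp_add]
    nlinarith [Real.exp_pos y]

variable (G : SimpleGraph U) (P Q : Finset U → Prop)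

/-- The indicator of the vertices that do not meet `X`. -/
def freeInd (X : Finset U) (u : U) : ℝ := if G.Meets X u then 0 else 1
/-- The indicator of the vertices that meet `X` and make it full. -/
def fullInd (X : Finset U) (u : U) : ℝ := if G.Meets X u ∧ P (insert u X) then 1 else 0
/-- The indicator of the vertices that meet `X` and make it critical, but not full. -/
def critInd (X : Finset U) (u : U) : ℝ :=
  if G.Meets X u ∧ ¬ P (insert u X) ∧ Q (insert u X) then 1 else 0
/-- The indicator of the vertices that meet `X` and make it neither full nor critical. -/
def restInd (X : Finset U) (u : U) : ℝ :=
  if G.Meets X u ∧ ¬ P (insert u X) ∧ ¬ Q (insert u X) then 1 else 0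

lemma freeInd_nonneg (X : Finset U) (u : U) : 0 ≤ freeInd G X u := by
  unfold freeInd; split_ifs <;> norm_num

lemma freeInd_le_one (X : Finset U) (u : U) : freeInd G X u ≤ 1 := by
  unfold freeInd; split_ifs <;> norm_num

lemma fullInd_nonneg (X : Finset U) (u : U) : 0 ≤ fullInd G P X u := by
  unfold fullInd; split_ifs <;> norm_num

lemma critInd_nonneg (X : Finset U) (u : U) : 0 ≤ critInd G P Q X u := by
  unfold critInd; split_ifs <;> norm_num

lemma restInd_nonneg (X : Finset U) (u : U) : 0 ≤ restInd G P Q X u := by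
  unfold restInd; split_ifs <;> norm_num

lemma ind_add_eq_one (X : Finset U) (u : U) :
    freeInd G X u + fullInd G P X u + critInd G P Q X u + restInd G P Q X u = 1 := by
  unfold freeInd fullInd critInd restInd
  by_cases h1 : G.Meets X u <;> by_cases h2 : P (insert u X) <;> by_cases h3 : Q (insert u X) <;>
    simp [h1, h2, h3]

lemma meets_insert_of_meets {X : Finset U} {u : U} (w : U) (h : G.Meets X u) :
    G.Meets (insert w X) u := h.mono (Finset.subset_insert _ _)

lemma freeInd_insert_mul (X : Finset U) (w u : U) :
    freeInd G X u * freeInd G (insert w X) u = freeInd G (insert w X) u := by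
  unfold freeInd
  by_cases h1 : G.Meets X u
  · simp [h1, G.meets_insert_of_meets w h1]
  · simp [h1]

lemma freeInd_insert_insert (X : Finset U) (w w' u : U) :
    freeInd G (insert w (insert w' X)) u = freeInd G (insert w X) u * freeInd G (insert w' X) u := by
  have : G.Meets (insert w (insert w' X)) u ↔ G.Meets (insert w X) u ∨ G.Meets (insert w' X) u := by
    simp only [Meets, Finset.mem_insert, or_and_right, exists_or, exists_eq_left]
    tauto
  unfold freeInd
  by_cases h1 : G.Meets (insert w X) u <;> by_cases h2 : G.Meets (insert w' X) u <;>
    simp [this, h1, h2]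

variable [Fintype U]

/-- The expected payment from the set `X` with `q + 2` draws, together with the payment for vertices
inserted earlier: `lam` is the measure of the single vertices that have already made the set full, and
`m` the measure of those that have made it critical. An inserted vertex uses up one of the draws,
two inserted vertices use up two. -/
def potential (q : ℕ) (X : Finset U) (lam : ℝ) (m : U → ℝ) : ℝ :=
  Real.exp 1 * lam * quietProb G (q + 1) X
    + Real.exp 1 ^ 2 / 4 * ∑ w, ∑ w', m w * m w' * quietProb G q (insert w (insert w' X))
    + ∑ w, m w * pairMean G P Q false (q + 1) w X
    + rewardMean G P Q (q + 2) X

lemma pairMean_one (b : Bool) (w : U) (X : Finset U) : pairMean G P Q b 1 w X = 0 := by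
  have h0 : ∀ w X, pairMean G P Q false 0 w X = 0 := fun w X => rfl
  rw [pairMean_succ]
  refine (div_eq_zero_iff.2 <| Or.inl <| Finset.sum_eq_zero fun u _ => ?_)
  simp [pairStep, h0]

lemma rewardMean_two (X : Finset U) : rewardMean G P Q 2 X = 0 := by
  have h0 : ∀ X, rewardMean G P Q 0 X = 0 := fun X => rfl
  have h00 : ∀ w X, pairMean G P Q true 0 w X = 0 := fun w X => rfl
  have h1 : ∀ X, rewardMean G P Q 1 X = 0 := fun X => by
    rw [rewardMean_succ]
    refine (div_eq_zero_iff.2 <| Or.inl <| Finset.sum_eq_zero fun u _ => ?_)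
    simp [h0, h00]
  rw [rewardMean_succ]
  refine (div_eq_zero_iff.2 <| Or.inl <| Finset.sum_eq_zero fun u _ => ?_)
  simp [h1, pairMean_one]

lemma potential_zero_le [Nonempty U] (X : Finset U) {lam : ℝ} (hlam : 0 ≤ lam) {m : U → ℝ}
    (hm : ∀ w, 0 ≤ m w) : potential G P Q 0 X lam m ≤ Real.exp (lam + ∑ w, m w) := by
  have h1 : ∑ w, ∑ w', m w * m w' = (∑ w, m w) ^ 2 := by
    rw [sq, Finset.sum_mul_sum]
  simp only [potential, quietProb_zero, pairMean_one, rewardMean_two, mul_one, mul_zero, add_zero,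
    Finset.sum_const_zero, zero_add, h1]
  refine le_trans ?_ (exp_one_mul_add_sq_le hlam (Finset.sum_nonneg fun w _ => hm w))
  have := mul_le_of_le_one_right (mul_nonneg (Real.exp_pos 1).le hlam) (quietProb_le_one G 1 X)
  linarith

/-- The part of `pairStep` that is not caused by a vertex making `X` itself critical. -/
def pairBound (q : ℕ) (X : Finset U) (w u : U) : ℝ :=
  freeInd G (insert w X) u * pairMean G P Q false (q + 1) w (insert u X)
    + Real.exp 1 * quietProb G (q + 1) (insert u X)
      * (freeInd G X u * (1 - freeInd G (insert w X) u) + restInd G P Q X u)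

lemma pairStep_le (b : Bool) (q : ℕ) (w : U) (X : Finset U) (u : U) :
    pairStep G P Q b (q + 1) w X u ≤ pairBound G P Q q X w u +
      if b = false then
        Real.exp 1 ^ 2 / 2 * critInd G P Q X u * quietProb G (q + 1) (insert u (insert w X))
      else 0 := by
  have hA := quietProb_nonneg G (q + 1) (insert u X)
  have hB := quietProb_nonneg G (q + 1) (insert u (insert w X))
  have hAB : quietProb G (q + 1) (insert u (insert w X)) ≤ quietProb G (q + 1) (insert u X) :=
    quietProb_anti G _ (Finset.insert_subset_insert _ (Finset.subset_insert _ _))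
  have hrest : ∀ b : Bool, 0 ≤ if b = false then
        Real.exp 1 ^ 2 / 2 * critInd G P Q X u * quietProb G (q + 1) (insert u (insert w X))
      else 0 := fun b => by
    have := critInd_nonneg G P Q X u
    split_ifs <;> positivity
  have he := Real.exp_pos 1
  have hmul := mul_le_mul_of_nonneg_left hAB he.le
  have hmul0 := mul_nonneg he.le hA
  unfold pairStep pairBound
  by_cases h1 : G.Meets (insert w X) u
  · have hf : freeInd G (insert w X) u = 0 := by simp [freeInd, h1]
    have hf0 := freeInd_nonneg G X u
    have hr0 := restInd_nonneg G P Q X u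
    have hpos : 0 ≤ Real.exp 1 * quietProb G (q + 1) (insert u X) *
      (freeInd G X u * (1 - 0) + restInd G P Q X u) := by positivity
    rw [hf, zero_mul, zero_add]
    by_cases h2 : ¬ P (insert u (insert w X)) ∨ P (insert u X)
    · simp only [h1, h2, not_true, if_true, if_false]
      exact add_nonneg hpos (hrest b)
    · rw [not_or] at h2
      by_cases h3 : G.Meets X u ∧ Q (insert u X)
      · simp only [h1, h2, h3, not_true, if_false, or_self, and_self, if_true]
        have hc : critInd G P Q X u = 1 := by simp [critInd, h3, h2.2]
        cases b
        · simp [hc]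
          nlinarith
        · simp
          nlinarith
      · simp only [h1, h2, h3, not_true, if_false, or_self]
        have hc : freeInd G X u + restInd G P Q X u = 1 := by
          have h0 := ind_add_eq_one G P Q X u
          have h01 : critInd G P Q X u = 0 := by
            unfold critInd; rw [if_neg]; tauto
          have h02 : fullInd G P X u = 0 := by
            unfold fullInd; rw [if_neg]; tauto
          linarith
        rw [sub_zero, mul_one, hc]
        have := hrest b
        split_ifs at this ⊢ <;> nlinarith
  · have h0 : ¬ G.Meets X u := fun h => h1 (G.meets_insert_of_meets w h)
    have hf : freeInd G (insert w X) u = 1 := by simp [freeInd, h1]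
    have hr : restInd G P Q X u = 0 := by simp [restInd, h0]
    simp only [h1, not_false_iff, if_true, hf, hr]
    have := hrest b
    linarith

lemma quietProb_succ' (r : ℕ) (X : Finset U) : quietProb G (r + 1) X =
    (∑ u, freeInd G X u * quietProb G r (insert u X)) / Fintype.card U := by
  rw [quietProb_succ]
  congr 1
  refine Finset.sum_congr rfl fun u _ => ?_
  unfold freeInd
  split_ifs <;> simp

lemma quietProb_pair_succ (r : ℕ) (X : Finset U) (w w' : U) :
    quietProb G (r + 1) (insert w (insert w' X)) =
    (∑ u, freeInd G X u * (freeInd G (insert w X) u * freeInd G (insert w' X) u *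
      quietProb G r (insert w (insert w' (insert u X))))) / Fintype.card U := by
  rw [quietProb_succ']
  congr 1
  refine Finset.sum_congr rfl fun u _ => ?_
  rw [freeInd_insert_insert, ← mul_assoc, ← mul_assoc, freeInd_insert_mul,
    Finset.insert_comm u w, Finset.insert_comm u w']

lemma rewardMean_succ_le (q : ℕ) (X : Finset U) : rewardMean G P Q (q + 3) X ≤
    (∑ u, (freeInd G X u + restInd G P Q X u) * rewardMean G P Q (q + 2) (insert u X))
        / Fintype.card U
      + Real.exp 1 * ((∑ u, fullInd G P X u) / Fintype.card U) * quietProb G (q + 2) X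
      + ∑ w, critInd G P Q X w / Fintype.card U * pairMean G P Q true (q + 2) w X := by
  rw [rewardMean_succ]
  have hterm : ∀ u, (if ¬ G.Meets X u then rewardMean G P Q (q + 2) (insert u X)
      else if P (insert u X) then
        if 2 ≤ q + 2 then Real.exp 1 * quietProb G (q + 2) (insert u X) else 0
      else if Q (insert u X) then pairMean G P Q true (q + 2) u X
      else rewardMean G P Q (q + 2) (insert u X)) ≤
      (freeInd G X u + restInd G P Q X u) * rewardMean G P Q (q + 2) (insert u X)
        + Real.exp 1 * quietProb G (q + 2) X * fullInd G P X u
        + critInd G P Q X u * pairMean G P Q true (q + 2) u X := by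
    intro u
    have hmul := mul_le_mul_of_nonneg_left
      (quietProb_anti G (q + 2) (Finset.subset_insert u X)) (Real.exp_pos 1).le
    unfold freeInd restInd fullInd critInd
    by_cases h1 : G.Meets X u <;> by_cases h2 : P (insert u X) <;> by_cases h3 : Q (insert u X) <;>
      simp [h1, h2, h3] <;> simpa using hmul
  refine (div_le_div_of_nonneg_right (Finset.sum_le_sum fun u _ => hterm u)
    (Nat.cast_nonneg _)).trans (le_of_eq ?_)
  rw [Finset.sum_add_distrib, Finset.sum_add_distrib, ← Finset.mul_sum, add_div, add_div]
  congr 1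
  · ring
  · rw [Finset.sum_div]
    exact Finset.sum_congr rfl fun u _ => by ring

lemma sum_pair_le (K : U → U → ℝ) (hK : ∀ w w', 0 ≤ K w w') (hsymm : ∀ w w', K w w' = K w' w)
    {m c : U → ℝ} (hc : ∀ w, 0 ≤ c w) :
    ∑ w, ∑ w', m w * m w' * K w w' + 2 * ∑ w, ∑ w', m w * c w' * K w w' ≤
      ∑ w, ∑ w', (m w + c w) * (m w' + c w') * K w w' := by
  have h1 : ∑ w, ∑ w', m w * c w' * K w w' = ∑ w, ∑ w', c w * m w' * K w w' := by
    rw [Finset.sum_comm]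
    refine Finset.sum_congr rfl fun w _ => Finset.sum_congr rfl fun w' _ => ?_
    rw [hsymm w' w]; ring
  have h2 : ∑ w, ∑ w', (m w + c w) * (m w' + c w') * K w w' =
      ∑ w, ∑ w', m w * m w' * K w w' + ∑ w, ∑ w', m w * c w' * K w w' +
      ∑ w, ∑ w', c w * m w' * K w w' + ∑ w, ∑ w', c w * c w' * K w w' := by
    simp only [← Finset.sum_add_distrib]
    exact Finset.sum_congr rfl fun w _ => Finset.sum_congr rfl fun w' _ => by ring
  have h3 : 0 ≤ ∑ w, ∑ w', c w * c w' * K w w' :=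
    Finset.sum_nonneg fun w _ => Finset.sum_nonneg fun w' _ =>
      mul_nonneg (mul_nonneg (hc w) (hc w')) (hK w w')
  linarith

end Exploration

section Exploration

open scoped Classical

variable {U : Type*} [Fintype U] (G : SimpleGraph U) (P Q : Finset U → Prop)

lemma sum_pairMean_le (q : ℕ) (X : Finset U) {m : U → ℝ} (hm : ∀ w, 0 ≤ m w) :
    ∑ w, m w * pairMean G P Q false (q + 2) w X +
      ∑ w, critInd G P Q X w / Fintype.card U * pairMean G P Q true (q + 2) w X ≤
    (∑ u, ∑ w, (m w + critInd G P Q X w / Fintype.card U) * pairBound G P Q q X w u)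
        / Fintype.card U
      + Real.exp 1 ^ 2 / 2 * ∑ w, ∑ u, m w * (critInd G P Q X u / Fintype.card U)
          * quietProb G (q + 1) (insert w (insert u X)) := by
  have hN : (0 : ℝ) ≤ Fintype.card U := Nat.cast_nonneg _
  have h1 : ∀ w, pairMean G P Q false (q + 2) w X ≤
      (∑ u, pairBound G P Q q X w u) / Fintype.card U +
        Real.exp 1 ^ 2 / 2 * ∑ u, critInd G P Q X u / Fintype.card U
          * quietProb G (q + 1) (insert w (insert u X)) := by
    intro w
    rw [pairMean_succ]
    refine (div_le_div_of_nonneg_right (Finset.sum_le_sum fun u _ =>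
      pairStep_le G P Q false q w X u) hN).trans (le_of_eq ?_)
    rw [Finset.sum_add_distrib, add_div, Finset.mul_sum]
    congr 1
    rw [Finset.sum_div]
    refine Finset.sum_congr rfl fun u _ => ?_
    rw [if_pos rfl, Finset.insert_comm]
    ring
  have h2 : ∀ w, pairMean G P Q true (q + 2) w X ≤
      (∑ u, pairBound G P Q q X w u) / Fintype.card U := by
    intro w
    rw [pairMean_succ]
    refine div_le_div_of_nonneg_right (Finset.sum_le_sum fun u _ => ?_) hN
    simpa using pairStep_le G P Q true q w X u
  calc _ ≤ ∑ w, m w * ((∑ u, pairBound G P Q q X w u) / Fintype.card U +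
        Real.exp 1 ^ 2 / 2 * ∑ u, critInd G P Q X u / Fintype.card U
          * quietProb G (q + 1) (insert w (insert u X))) +
      ∑ w, critInd G P Q X w / Fintype.card U *
        ((∑ u, pairBound G P Q q X w u) / Fintype.card U) := by
        refine add_le_add (Finset.sum_le_sum fun w _ => mul_le_mul_of_nonneg_left (h1 w) (hm w))
          (Finset.sum_le_sum fun w _ => mul_le_mul_of_nonneg_left (h2 w) ?_)
        exact div_nonneg (critInd_nonneg G P Q X w) hN
    _ = _ := by
        rw [Finset.sum_comm, Finset.mul_sum, Finset.sum_div, ← Finset.sum_add_distrib,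
          ← Finset.sum_add_distrib]
        refine Finset.sum_congr rfl fun w _ => ?_
        simp only [mul_assoc (m w), ← Finset.mul_sum]
        ring

/-- The recursion for the potential. A vertex `w` of the measure `m'` that is met by a free vertex `u` is
counted as having completed the copy together with `u`, and its mass moves to `lam`. If `u` is of the
remaining kind, then all of `m'` moves to `lam`, and the pairs and the old `lam` are lost. -/
lemma potential_succ_le (q : ℕ) (X : Finset U) {lam : ℝ} {m m' : U → ℝ} (hm : ∀ w, 0 ≤ m w)
    (hm' : ∀ w, m' w = m w + critInd G P Q X w / Fintype.card U) :
    potential G P Q (q + 1) X lam m ≤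
      (∑ u, (freeInd G X u * potential G P Q q (insert u X)
          (lam + (∑ u, fullInd G P X u) / Fintype.card U
            + ∑ w, m' w * (1 - freeInd G (insert w X) u))
          (fun w => m' w * freeInd G (insert w X) u)
        + restInd G P Q X u * potential G P Q q (insert u X) (∑ w, m' w) 0)) / Fintype.card U := by
  have hN : (0 : ℝ) ≤ Fintype.card U := Nat.cast_nonneg _
  set δ := (∑ u, fullInd G P X u) / (Fintype.card U : ℝ) with hδ
  set K : U → U → ℝ := fun w w' => quietProb G (q + 1) (insert w (insert w' X)) with hK
  -- a pair is never completed directly after its first vertex was inserted, hence the pairs that are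
  -- added are `m ⊗ c` and `c ⊗ m`, and the square of the enlarged measure covers them
  have hpair := sum_pair_le K (fun w w' => quietProb_nonneg G _ _)
    (fun w w' => by simp only [hK, Finset.insert_comm]) (m := m)
    (c := fun w => critInd G P Q X w / Fintype.card U)
    (fun w => div_nonneg (critInd_nonneg G P Q X w) hN)
  have hsum := sum_pairMean_le G P Q q X hm
  have hrew := rewardMean_succ_le G P Q q X
  simp only [← hm'] at hpair hsum
  have hpair' : ∑ w, ∑ w', m' w * m' w' * K w w' =
      (∑ u, freeInd G X u * ∑ w, ∑ w', (m' w * freeInd G (insert w X) u) *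
        (m' w' * freeInd G (insert w' X) u) *
          quietProb G q (insert w (insert w' (insert u X)))) / Fintype.card U := by
    simp only [hK, quietProb_pair_succ, Finset.mul_sum]
    conv_rhs => rw [Finset.sum_comm, Finset.sum_div]
    refine Finset.sum_congr rfl fun w _ => ?_
    conv_rhs => rw [Finset.sum_comm, Finset.sum_div]
    refine Finset.sum_congr rfl fun w' _ => ?_
    rw [← mul_div_assoc, Finset.mul_sum]
    congr 1
    exact Finset.sum_congr rfl fun u _ => by ring
  have hterm : ∀ u, freeInd G X u * potential G P Q q (insert u X)
          (lam + δ + ∑ w, m' w * (1 - freeInd G (insert w X) u))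
          (fun w => m' w * freeInd G (insert w X) u)
        + restInd G P Q X u * potential G P Q q (insert u X) (∑ w, m' w) 0 =
      Real.exp 1 * (lam + δ) * (freeInd G X u * quietProb G (q + 1) (insert u X))
      + Real.exp 1 ^ 2 / 4 * (freeInd G X u * ∑ w, ∑ w', (m' w * freeInd G (insert w X) u) *
        (m' w' * freeInd G (insert w' X) u) *
          quietProb G q (insert w (insert w' (insert u X))))
      + ∑ w, m' w * pairBound G P Q q X w u
      + (freeInd G X u + restInd G P Q X u) * rewardMean G P Q (q + 2) (insert u X) := by
    intro u
    have hb : ∑ w, m' w * pairBound G P Q q X w u =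
        freeInd G X u * ∑ w, m' w * freeInd G (insert w X) u *
          pairMean G P Q false (q + 1) w (insert u X)
        + freeInd G X u * (Real.exp 1 * (∑ w, m' w * (1 - freeInd G (insert w X) u)) *
          quietProb G (q + 1) (insert u X))
        + restInd G P Q X u * (Real.exp 1 * (∑ w, m' w) * quietProb G (q + 1) (insert u X)) := by
      simp only [Finset.mul_sum, Finset.sum_mul, ← Finset.sum_add_distrib]
      refine Finset.sum_congr rfl fun w _ => ?_
      rw [pairBound]
      linear_combination (-(m' w * pairMean G P Q false (q + 1) w (insert u X))) *
        freeInd_insert_mul G X w u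
    rw [hb]
    simp only [potential, Pi.zero_apply, zero_mul, Finset.sum_const_zero, mul_zero, add_zero]
    ring
  simp only [hterm]
  rw [Finset.sum_add_distrib, Finset.sum_add_distrib, Finset.sum_add_distrib, ← Finset.mul_sum,
    ← Finset.mul_sum, add_div, add_div, add_div, mul_div_assoc, mul_div_assoc, ← hpair',
    ← quietProb_succ']
  unfold potential
  simp only [hK] at hpair hsum ⊢
  have hpair4 := mul_le_mul_of_nonneg_left hpair (by positivity : 0 ≤ Real.exp 1 ^ 2 / 4)
  rw [← hδ] at hrew
  rw [mul_add] at hpair4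
  linarith

theorem potential_le [Nonempty U] (hP : ∀ X u, ¬ G.Meets X u → P (insert u X) → P X)
    (hQ : ∀ X u, ¬ G.Meets X u → Q (insert u X) → Q X) (q : ℕ) :
    ∀ (X : Finset U) (lam : ℝ) (m : U → ℝ), ¬ P X → ¬ Q X → 0 ≤ lam → (∀ w, 0 ≤ m w) →
      potential G P Q q X lam m ≤ Real.exp (lam + ∑ w, m w) := by
  induction q with
  | zero => intro X lam m _ _ hlam hm; exact potential_zero_le G P Q X hlam hm
  | succ q ih =>
    intro X lam m hPX hQX hlam hm
    have hN : (0 : ℝ) < Fintype.card U := by exact_mod_cast Fintype.card_pos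
    set m' : U → ℝ := fun w => m w + critInd G P Q X w / Fintype.card U with hm'
    have hm'0 : ∀ w, 0 ≤ m' w := fun w =>
      add_nonneg (hm w) (div_nonneg (critInd_nonneg G P Q X w) hN.le)
    refine (potential_succ_le G P Q q X hm (m' := m') fun w => rfl).trans ?_
    set δ := (∑ u, fullInd G P X u) / (Fintype.card U : ℝ) with hδ
    set c := (∑ u, critInd G P Q X u) / (Fintype.card U : ℝ) with hc
    have hδ0 : 0 ≤ δ := div_nonneg (Finset.sum_nonneg fun u _ => fullInd_nonneg G P X u) hN.le
    have hc0 : 0 ≤ c := div_nonneg (Finset.sum_nonneg fun u _ => critInd_nonneg G P Q X u) hN.le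
    have hm's : ∑ w, m' w = ∑ w, m w + c := by
      rw [hc, Finset.sum_div, ← Finset.sum_add_distrib]
    set γ := ∑ w, m w with hγ
    have hγ0 : 0 ≤ γ := Finset.sum_nonneg fun w _ => hm w
    have hfree : ∀ u, freeInd G X u * potential G P Q q (insert u X)
        (lam + δ + ∑ w, m' w * (1 - freeInd G (insert w X) u))
        (fun w => m' w * freeInd G (insert w X) u) ≤
        freeInd G X u * Real.exp (lam + δ + (γ + c)) := by
      intro u
      by_cases hu : G.Meets X u
      · simp [freeInd, hu]
      · refine mul_le_mul_of_nonneg_left ?_ (freeInd_nonneg G X u)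
        refine (ih (insert u X) _ _ (fun h => hPX (hP X u hu h)) (fun h => hQX (hQ X u hu h)) ?_
          fun w => mul_nonneg (hm'0 w) (freeInd_nonneg G _ u)).trans (le_of_eq ?_)
        · have : 0 ≤ ∑ w, m' w * (1 - freeInd G (insert w X) u) := Finset.sum_nonneg fun w _ =>
            mul_nonneg (hm'0 w) (sub_nonneg.2 (freeInd_le_one G _ u))
          positivity
        · rw [add_assoc (lam + δ), ← Finset.sum_add_distrib, ← hm's]
          congr 2
          exact Finset.sum_congr rfl fun w _ => by ring
    have hrest : ∀ u, restInd G P Q X u * potential G P Q q (insert u X) (∑ w, m' w) 0 ≤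
        restInd G P Q X u * Real.exp (γ + c) := by
      intro u
      by_cases hu : G.Meets X u ∧ ¬ P (insert u X) ∧ ¬ Q (insert u X)
      · refine mul_le_mul_of_nonneg_left ?_ (restInd_nonneg G P Q X u)
        refine (ih (insert u X) _ 0 hu.2.1 hu.2.2 (by rw [hm's]; positivity)
          fun w => le_rfl).trans (le_of_eq ?_)
        simp [hm's]
      · simp [restInd, hu]
    refine (div_le_div_of_nonneg_right (Finset.sum_le_sum fun u _ =>
      add_le_add (hfree u) (hrest u)) hN.le).trans ?_
    rw [Finset.sum_add_distrib, ← Finset.sum_mul, ← Finset.sum_mul, add_div,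
      mul_div_right_comm, mul_div_right_comm]
    set ρ := (∑ u, restInd G P Q X u) / (Fintype.card U : ℝ) with hρ
    have hρ0 : 0 ≤ ρ := div_nonneg (Finset.sum_nonneg fun u _ => restInd_nonneg G P Q X u) hN.le
    have hφ : (∑ u, freeInd G X u) / (Fintype.card U : ℝ) = 1 - (δ + c) - ρ := by
      have h1 : ∑ u, freeInd G X u + ∑ u, fullInd G P X u + ∑ u, critInd G P Q X u
          + ∑ u, restInd G P Q X u = Fintype.card U := by
        simp only [← Finset.sum_add_distrib, ind_add_eq_one]
        simp
      rw [hδ, hc, hρ]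
      field_simp
      linarith
    rw [hφ]
    -- `(1 - x) * exp x ≤ 1` with `x = δ + c`, and vertices of the remaining kind only gain
    have h1 : (1 - (δ + c)) * Real.exp (δ + c) ≤ 1 := by
      have h := Real.add_one_le_exp (-(δ + c))
      have h2 : Real.exp (-(δ + c)) * Real.exp (δ + c) = 1 := by rw [← Real.exp_add]; simp
      nlinarith [Real.exp_pos (δ + c)]
    have e1 : Real.exp (lam + δ + (γ + c)) = Real.exp (lam + γ) * Real.exp (δ + c) := by
      rw [← Real.exp_add]; ring_nf
    have e2 : Real.exp (γ + c) ≤ Real.exp (lam + δ + (γ + c)) :=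
      Real.exp_le_exp.2 (by linarith)
    calc _ ≤ (1 - (δ + c) - ρ) * Real.exp (lam + δ + (γ + c))
          + ρ * Real.exp (lam + δ + (γ + c)) := by gcongr
      _ = Real.exp (lam + γ) * ((1 - (δ + c)) * Real.exp (δ + c)) := by rw [e1]; ring
      _ ≤ Real.exp (lam + γ) := mul_le_of_le_one_right (Real.exp_pos _).le h1

/-- The expected payment is at most one. -/
theorem rewardMean_le_one [Nonempty U] (hP : ∀ X u, ¬ G.Meets X u → P (insert u X) → P X)
    (hQ : ∀ X u, ¬ G.Meets X u → Q (insert u X) → Q X) (hP0 : ¬ P ∅) (hQ0 : ¬ Q ∅) (q : ℕ) :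
    rewardMean G P Q (q + 2) ∅ ≤ 1 := by
  have h := potential_le G P Q hP hQ q ∅ 0 0 hP0 hQ0 le_rfl fun w => le_rfl
  simpa [potential] using h

end Exploration

/-! ### Cores, full sets and critical sets -/

section Core

open scoped Classical

variable {U V : Type*}

/-- The core of `X`: the vertices of `X` that are not isolated in `G[X]`. -/
def core (G : SimpleGraph U) (X : Set U) : Set U :=
  {x | x ∈ X ∧ ∃ y ∈ X, G.Adj x y}

/-- `X` is full if its core induces a copy of `M(H)`. -/
def IsFull (H : SimpleGraph V) (G : SimpleGraph U) (X : Finset U) : Prop :=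
  Nonempty (G.induce (G.core X) ≃g H.induce (H.core Set.univ))

/-- `X` is critical if its core induces a copy of `M(H - v)` for some detectable `v`. -/
def IsCritical (H : SimpleGraph V) (G : SimpleGraph U) (X : Finset U) : Prop :=
  ∃ v, H.IsDetectable v ∧ Nonempty (G.induce (G.core X) ≃g H.induce (H.core {v}ᶜ))

lemma core_mono (G : SimpleGraph U) {X Y : Set U} (h : X ⊆ Y) : G.core X ⊆ G.core Y :=
  fun _ ⟨hx, y, hy, hxy⟩ => ⟨h hx, y, h hy, hxy⟩

lemma core_eq_of_subset (G : SimpleGraph U) {X Y : Set U} (h : X ⊆ Y)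
    (hY : ∀ y ∈ Y, y ∉ X → ∀ z ∈ Y, ¬ G.Adj y z) : G.core Y = G.core X := by
  refine Set.Subset.antisymm ?_ (G.core_mono h)
  rintro x ⟨hx, y, hy, hxy⟩
  refine ⟨by_contra fun hx' => hY x hx hx' y hy hxy, y,
    by_contra fun hy' => hY y hy hy' x hx hxy.symm, hxy⟩

lemma core_insert_of_not_meets {G : SimpleGraph U} {X : Finset U} {u : U} (h : ¬ G.Meets X u) :
    G.core (insert u X : Finset U) = G.core X := by
  refine G.core_eq_of_subset (by simp) fun y hy hyX z hz hyz => h (Or.inr ?_)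
  simp only [Finset.coe_insert, Set.mem_insert_iff, Finset.mem_coe] at hy hz hyX
  obtain rfl : y = u := by tauto
  rcases hz with rfl | hz
  · exact (G.irrefl hyz).elim
  · exact ⟨z, hz, hyz.symm⟩

lemma IsFull.of_insert {H : SimpleGraph V} {G : SimpleGraph U} (X : Finset U) (u : U)
    (h : ¬ G.Meets X u) (hX : IsFull H G (insert u X)) : IsFull H G X := by
  rwa [IsFull, core_insert_of_not_meets h] at hX

lemma IsCritical.of_insert {H : SimpleGraph V} {G : SimpleGraph U} (X : Finset U) (u : U)
    (h : ¬ G.Meets X u) (hX : IsCritical H G (insert u X)) : IsCritical H G X := by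
  rwa [IsCritical, core_insert_of_not_meets h] at hX

/-- The non-isolated part of `H[X]` is the subgraph of `H` induced by the core of `X`. -/
def nonIsolatedPartIso (H : SimpleGraph V) (X : Set V) :
    (H.induce X).nonIsolatedPart ≃g H.induce (H.core X) where
  toFun x := ⟨x.1.1, x.1.2, by
    obtain ⟨y, hy⟩ := exists_adj_iff_not_isIsolated.2 x.2
    exact ⟨y.1, y.2, hy⟩⟩
  invFun x := ⟨⟨x.1, x.2.1⟩, by
    obtain ⟨y, hy, hxy⟩ := x.2.2
    exact exists_adj_iff_not_isIsolated.1 ⟨⟨y, hy⟩, hxy⟩⟩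
  left_inv _ := rfl
  right_inv _ := rfl
  map_rel_iff' := Iff.rfl

lemma isObscure_iff (H : SimpleGraph V) (v : V) : H.IsObscure v ↔ ¬ H.IsIsolated v ∧
    ∃ v₁ v₂ : V, v₁ ≠ v₂ ∧ ¬ H.IsIsolated v₁ ∧ ¬ H.IsIsolated v₂ ∧ 0 < H.degreeInto {v₁}ᶜ v₂ ∧
      (H.induce (H.core {v}ᶜ)).IsIndContained (H.induce {v₁, v₂}ᶜ) := by
  have h : ∀ v₁ v₂, (H.induce {v}ᶜ).nonIsolatedPart.IsIndContained (H.induce {v₁, v₂}ᶜ) ↔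
      (H.induce (H.core {v}ᶜ)).IsIndContained (H.induce {v₁, v₂}ᶜ) := fun v₁ v₂ =>
    ⟨fun ⟨f⟩ => ⟨f.comp (nonIsolatedPartIso H {v}ᶜ).symm.toEmbedding⟩,
      fun ⟨f⟩ => ⟨f.comp (nonIsolatedPartIso H {v}ᶜ).toEmbedding⟩⟩
  simp only [IsObscure, h]

lemma isDetectable_of_iso {H : SimpleGraph V} {v w : V} (hv : H.IsDetectable v)
    (hw : ¬ H.IsIsolated w) (e : H.induce (H.core {w}ᶜ) ≃g H.induce (H.core {v}ᶜ)) :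
    H.IsDetectable w := by
  refine ⟨hw, fun h => hv.2 ?_⟩
  rw [isObscure_iff] at h ⊢
  obtain ⟨-, v₁, v₂, h1, h2, h3, h4, ⟨f⟩⟩ := h
  exact ⟨hv.1, v₁, v₂, h1, h2, h3, h4, ⟨f.comp e.symm.toEmbedding⟩⟩

lemma isCritical_iff_isDetectable {H : SimpleGraph V} {X : Finset V} {w : V}
    (hw : ¬ H.IsIsolated w) (h : H.core X = H.core {w}ᶜ) :
    IsCritical H H X ↔ H.IsDetectable w := by
  rw [IsCritical, h]
  exact ⟨fun ⟨v, hv, ⟨e⟩⟩ => isDetectable_of_iso hv hw e, fun hw => ⟨w, hw, ⟨Iso.refl⟩⟩⟩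

lemma exists_adj_of_two_le (H : SimpleGraph V) (hE : 2 ≤ H.edgeSet.ncard) :
    ∃ a b, H.Adj a b := by
  obtain ⟨e, he⟩ := Set.nonempty_of_ncard_ne_zero (s := H.edgeSet) (by omega)
  induction e with | h a b => exact ⟨a, b, he⟩

lemma not_isFull_empty (H : SimpleGraph V) (G : SimpleGraph U) (hE : 2 ≤ H.edgeSet.ncard) :
    ¬ IsFull H G ∅ := by
  rintro ⟨e⟩
  obtain ⟨a, b, hab⟩ := H.exists_adj_of_two_le hE
  have := (e.symm ⟨a, trivial, b, trivial, hab⟩).2.1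
  simp at this

variable [Finite V]

lemma degreeInto_pos_iff (H : SimpleGraph V) (W : Set V) (v : V) :
    0 < H.degreeInto W v ↔ ∃ w ∈ W, H.Adj v w := by
  rw [degreeInto, Set.ncard_pos (Set.toFinite _)]
  constructor
  · rintro ⟨w, h1, h2⟩; exact ⟨w, h2, h1⟩
  · rintro ⟨w, h1, h2⟩; exact ⟨w, h2, h1⟩

lemma isFull_iff (H : SimpleGraph V) (X : Finset V) :
    IsFull H H X ↔ H.core X = H.core Set.univ := by
  constructor
  · rintro ⟨e⟩
    refine Set.eq_of_subset_of_ncard_le (H.core_mono (Set.subset_univ _)) (le_of_eq ?_)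
      (Set.toFinite _)
    exact (Nat.card_congr e.toEquiv).symm
  · intro h
    rw [IsFull, h]
    exact ⟨Iso.refl⟩

/-- At most one further vertex can attach itself to a critical set: the last two vertices `z` and `y`
that do would witness that `v` is obscure. -/
lemma not_isCritical_of_meets (H : SimpleGraph V) {X Y Z : Finset V} {y z : V} (hXY : X ⊆ Y)
    (hy : ∃ x ∈ Y, H.Adj x y) (hyX : y ∉ X) (hYZ : Y ⊆ Z) (hyZ : y ∈ Z)
    (hz : ∃ x ∈ Z, H.Adj x z) (hzZ : z ∉ Z) : ¬ IsCritical H H X := by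
  rintro ⟨v, hv, ⟨e⟩⟩
  obtain ⟨x, hxY, hxy⟩ := hy
  obtain ⟨x', hxZ, hxz⟩ := hz
  refine hv.2 ((isObscure_iff H v).2 ⟨hv.1, z, y, fun h => hzZ (h ▸ hyZ),
    exists_adj_iff_not_isIsolated.1 ⟨x', hxz.symm⟩, exists_adj_iff_not_isIsolated.1 ⟨x, hxy.symm⟩,
    (degreeInto_pos_iff _ _ _).2 ⟨x, fun h => hzZ (h ▸ hYZ hxY), hxy.symm⟩, ⟨?_⟩⟩)
  refine (induceHomOfLE H ?_).comp e.symm.toEmbedding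
  intro a ha
  have haX : a ∈ X := ha.1
  simp only [Set.mem_compl_iff, Set.mem_insert_iff, Set.mem_singleton_iff, not_or]
  exact ⟨fun h => hzZ (h ▸ hYZ (hXY haX)), fun h => hyX (h ▸ haX)⟩

/-- If `M(H - v)` is empty, then all edges contain `v`, and the other ends of two of them witness that
`v` is obscure. This is where the number of edges matters. -/
lemma not_isCritical_empty (H : SimpleGraph V) (G : SimpleGraph U) (hE : 2 ≤ H.edgeSet.ncard) :
    ¬ IsCritical H G ∅ := by
  rintro ⟨v, hv, ⟨e⟩⟩
  have hempty : IsEmpty (H.core {v}ᶜ) := ⟨fun x => by simpa using (e.symm x).2.1⟩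
  -- every edge contains `v`
  have hedge : ∀ a b, H.Adj a b → a = v ∨ b = v := by
    intro a b hab
    by_contra h
    rw [not_or] at h
    exact hempty.false ⟨a, h.1, b, h.2, hab⟩
  obtain ⟨e₁, he₁, e₂, he₂, hne⟩ := (Set.one_lt_ncard (Set.toFinite _)).1 hE
  have hform : ∀ e ∈ H.edgeSet, ∃ a, H.Adj v a ∧ e = s(v, a) := by
    intro e he
    induction e with
    | h a b =>
      rcases hedge a b he with rfl | rfl
      · exact ⟨b, he, rfl⟩
      · exact ⟨a, Adj.symm he, Sym2.eq_swap⟩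
  obtain ⟨a, ha, rfl⟩ := hform e₁ he₁
  obtain ⟨b, hb, rfl⟩ := hform e₂ he₂
  refine hv.2 ((isObscure_iff H v).2 ⟨hv.1, a, b, fun h => hne (h ▸ rfl),
    exists_adj_iff_not_isIsolated.1 ⟨v, ha.symm⟩, exists_adj_iff_not_isIsolated.1 ⟨v, hb.symm⟩,
    (degreeInto_pos_iff _ _ _).2 ⟨v, ha.ne, hb.symm⟩, ⟨⟨⟨fun x => (hempty.false x).elim,
      fun x => (hempty.false x).elim⟩, fun {x} => (hempty.false x).elim⟩⟩⟩)

end Core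

section Transport

open scoped Classical

variable {U V : Type*} {G : SimpleGraph U} {H : SimpleGraph V} (ψ : H ↪g G)

lemma core_image (X : Set V) : G.core (ψ '' X) = ψ '' H.core X := by
  ext x
  constructor
  · rintro ⟨⟨a, ha, rfl⟩, _, ⟨b, hb, rfl⟩, hab⟩
    exact ⟨a, ⟨ha, b, hb, ψ.map_adj_iff.1 hab⟩, rfl⟩
  · rintro ⟨a, ⟨ha, b, hb, hab⟩, rfl⟩
    exact ⟨⟨a, ha, rfl⟩, ψ b, ⟨b, hb, rfl⟩, ψ.map_adj_iff.2 hab⟩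

/-- An embedding identifies `H[X]` with the subgraph induced by the image of `X`. -/
def induceImageIso (X : Set V) : H.induce X ≃g G.induce (ψ '' X) where
  toEquiv := Equiv.Set.image ψ X ψ.injective
  map_rel_iff' := ψ.map_adj_iff

lemma isFull_map (X : Finset V) : IsFull H G (X.map ψ.toEmbedding) ↔ IsFull H H X := by
  have h : G.core (X.map ψ.toEmbedding : Finset U) = ψ '' H.core X := by
    rw [Finset.coe_map]; exact core_image ψ X
  rw [IsFull, h, IsFull]
  exact ⟨fun ⟨e⟩ => ⟨(induceImageIso ψ _).trans e⟩, fun ⟨e⟩ => ⟨(induceImageIso ψ _).symm.trans e⟩⟩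

lemma isCritical_map (X : Finset V) :
    IsCritical H G (X.map ψ.toEmbedding) ↔ IsCritical H H X := by
  have h : G.core (X.map ψ.toEmbedding : Finset U) = ψ '' H.core X := by
    rw [Finset.coe_map]; exact core_image ψ X
  rw [IsCritical, h, IsCritical]
  exact ⟨fun ⟨v, hv, ⟨e⟩⟩ => ⟨v, hv, ⟨(induceImageIso ψ _).trans e⟩⟩,
    fun ⟨v, hv, ⟨e⟩⟩ => ⟨v, hv, ⟨(induceImageIso ψ _).symm.trans e⟩⟩⟩

lemma meets_map (X : Finset V) (u : V) : G.Meets (X.map ψ.toEmbedding) (ψ u) ↔ H.Meets X u := by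
  simp [Meets]

lemma map_insert' (X : Finset V) (u : V) :
    insert (ψ u) (X.map ψ.toEmbedding) = (insert u X).map ψ.toEmbedding := by
  rw [Finset.map_insert]; rfl

lemma quiet_map (l : List V) : ∀ X : Finset V,
    G.Quiet (X.map ψ.toEmbedding) (l.map ψ) ↔ H.Quiet X l := by
  induction l with
  | nil => intro X; exact Iff.rfl
  | cons u l ih =>
    intro X
    simp only [List.map_cons, Quiet, meets_map, map_insert', ih]

lemma pairReward_map (l : List V) : ∀ (b : Bool) (w : V) (X : Finset V),
    pairReward G (IsFull H G) (IsCritical H G) b (ψ w) (X.map ψ.toEmbedding) (l.map ψ) =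
      pairReward H (IsFull H H) (IsCritical H H) b w X l := by
  induction l with
  | nil => intro b w X; rfl
  | cons u l ih =>
    intro b w X
    simp only [List.map_cons, pairReward, map_insert', meets_map, isFull_map, isCritical_map,
      quiet_map, ih, List.length_map]

lemma reward_map (l : List V) : ∀ X : Finset V,
    reward G (IsFull H G) (IsCritical H G) (X.map ψ.toEmbedding) (l.map ψ) =
      reward H (IsFull H H) (IsCritical H H) X l := by
  induction l with
  | nil => intro X; rfl
  | cons u l ih =>
    intro X
    simp only [List.map_cons, reward, map_insert', meets_map, isFull_map, isCritical_map,
      quiet_map, ih, List.length_map, pairReward_map]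

end Transport

/-! ### The reward of a labelling of `H` -/

section Labelling

open scoped Classical

variable {V : Type*} (H : SimpleGraph V) {k : ℕ} (σ : Fin k ≃ V)

lemma drop_ofFn (i : Fin k) :
    (List.ofFn σ).drop i = σ i :: (List.ofFn σ).drop (i + 1) := by
  rw [List.drop_eq_getElem_cons (by simp)]
  simp

/-- The indices `i₁ < i₂` are the last two back-attached indices of the labelling `σ`. -/
structure IsLastTwo (H : SimpleGraph V) (σ : Fin k ≃ V) (i₁ i₂ : Fin k) : Prop where
  lt : i₁ < i₂
  left : H.IsBackAttached σ i₁
  right : H.IsBackAttached σ i₂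
  last : ∀ j, H.IsBackAttached σ j → j ≤ i₁ ∨ j = i₂

lemma isBright_iff_last_two {H : SimpleGraph V} {σ : Fin k ≃ V} {i₁ i₂ : Fin k}
    (h : H.IsLastTwo σ i₁ i₂) :
    H.IsBright σ ↔ H.IsDetectable (σ i₁) ∧ H.IsDetectable (σ i₂) := by
  have hlt := h.lt
  constructor
  · rintro ⟨j₁, j₂, hj, hB₁, hB₂, hl, hd₁, hd₂⟩
    have e1 := h.last _ hB₁
    have e2 := h.last _ hB₂
    have e3 := hl _ h.left
    have e4 := hl _ h.right
    have : j₁ = i₁ ∧ j₂ = i₂ := by omega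
    rw [← this.1, ← this.2]
    exact ⟨hd₁, hd₂⟩
  · rintro ⟨hd₁, hd₂⟩
    exact ⟨i₁, i₂, h.lt, h.left, h.right, h.last, hd₁, hd₂⟩

variable [Fintype V]

/-- The set of the first `i` vertices of the labelling `σ`. -/
def initialSet (i : ℕ) : Finset V := Finset.univ.filter fun v => (σ.symm v : ℕ) < i

variable {σ} in
@[simp] lemma mem_initialSet {i : ℕ} {v : V} : v ∈ initialSet σ i ↔ (σ.symm v : ℕ) < i := by
  simp [initialSet]

lemma insert_initialSet (i : Fin k) : insert (σ i) (initialSet σ i) = initialSet σ (i + 1) := by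
  ext v
  rw [Finset.mem_insert, mem_initialSet, mem_initialSet, ← Equiv.symm_apply_eq, Fin.ext_iff]
  omega

lemma initialSet_zero : initialSet σ 0 = ∅ := by ext v; simp

variable {H σ}

lemma isBackAttached_iff_exists {i : Fin k} :
    H.IsBackAttached σ i ↔ ∃ j < i, H.Adj (σ j) (σ i) := by
  rw [IsBackAttached, degreeInto_pos_iff]
  constructor
  · rintro ⟨_, ⟨j, hj, rfl⟩, h⟩
    exact ⟨j, lt_of_le_of_ne hj fun e => H.irrefl (e ▸ h), h.symm⟩
  · rintro ⟨j, hj, h⟩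
    exact ⟨_, ⟨j, hj.le, rfl⟩, h.symm⟩

lemma isBackAttached_iff_meets {i : Fin k} :
    H.IsBackAttached σ i ↔ H.Meets (initialSet σ i) (σ i) := by
  rw [isBackAttached_iff_exists, Meets]
  simp only [mem_initialSet, Equiv.symm_apply_apply, lt_irrefl, false_or]
  constructor
  · rintro ⟨j, hj, h⟩; exact ⟨σ j, by simpa using hj, h⟩
  · rintro ⟨v, hv, h⟩; exact ⟨σ.symm v, hv, by simpa using h⟩

lemma IsBackAttached.not_isIsolated {i : Fin k} (h : H.IsBackAttached σ i) :
    ¬ H.IsIsolated (σ i) := by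
  obtain ⟨j, -, hj⟩ := isBackAttached_iff_exists.1 h
  exact hj.not_isIsolated_right

lemma isIsolated_of_forall_not {i : Fin k} (h : ∀ j, i ≤ j → ¬ H.IsBackAttached σ j) :
    H.IsIsolated (σ i) := by
  intro v hv
  obtain ⟨j, rfl⟩ := σ.surjective v
  rcases lt_trichotomy i j with hij | rfl | hij
  · exact h j hij.le (isBackAttached_iff_exists.2 ⟨i, hij, hv⟩)
  · exact H.irrefl hv
  · exact h i le_rfl (isBackAttached_iff_exists.2 ⟨j, hij, hv.symm⟩)

lemma quiet_drop {i : ℕ} (h : ∀ j : Fin k, i ≤ j → ¬ H.IsBackAttached σ j) :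
    H.Quiet (initialSet σ i) ((List.ofFn σ).drop i) := by
  rcases le_or_gt k i with hi | hi
  · rw [List.drop_eq_nil_of_le (by simpa using hi)]; trivial
  · have hd := drop_ofFn σ ⟨i, hi⟩
    have hins := insert_initialSet σ ⟨i, hi⟩
    simp only at hd hins
    rw [hd, Quiet, hins]
    exact ⟨fun hm => h ⟨i, hi⟩ le_rfl (isBackAttached_iff_meets.2 hm),
      quiet_drop fun j hj => h j (by omega)⟩
termination_by k - i

lemma core_initialSet_eq_univ {i : ℕ} (h : ∀ j : Fin k, i ≤ j → ¬ H.IsBackAttached σ j) :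
    H.core (initialSet σ i) = H.core Set.univ := by
  refine (H.core_eq_of_subset (Set.subset_univ _) fun y _ hy z _ => ?_).symm
  obtain ⟨j, rfl⟩ := σ.surjective y
  simp only [Finset.mem_coe, mem_initialSet, Equiv.symm_apply_apply, not_lt] at hy
  exact isIsolated_of_forall_not (fun j' hj' => h j' (hy.trans hj')) z

lemma isFull_initialSet {i : ℕ} (h : ∀ j : Fin k, i ≤ j → ¬ H.IsBackAttached σ j) :
    IsFull H H (initialSet σ i) :=
  (isFull_iff H _).2 (core_initialSet_eq_univ h)

lemma not_isFull_of_notMem {X : Finset V} {v : V} (hv : ¬ H.IsIsolated v) (hX : v ∉ X) :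
    ¬ IsFull H H X := by
  intro h
  rw [isFull_iff] at h
  obtain ⟨w, hw⟩ := exists_adj_iff_not_isIsolated.2 hv
  have : v ∈ H.core X := h ▸ ⟨trivial, w, trivial, hw⟩
  exact hX this.1

lemma not_isFull_initialSet {i : ℕ} {j : Fin k} (hij : i ≤ j) (hj : H.IsBackAttached σ j) :
    ¬ IsFull H H (initialSet σ i) :=
  not_isFull_of_notMem hj.not_isIsolated (by simpa using hij)

lemma not_isCritical_initialSet {i : ℕ} {j₁ j₂ : Fin k} (hij : i ≤ j₁) (hj : j₁ < j₂)
    (h₁ : H.IsBackAttached σ j₁) (h₂ : H.IsBackAttached σ j₂) :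
    ¬ IsCritical H H (initialSet σ i) := by
  obtain ⟨a, ha, hadj⟩ := isBackAttached_iff_exists.1 h₁
  obtain ⟨b, hb, hbdj⟩ := isBackAttached_iff_exists.1 h₂
  refine not_isCritical_of_meets H (X := initialSet σ i) (Y := initialSet σ (j₁ + 1))
    (Z := initialSet σ j₂) (y := σ j₁) (z := σ j₂) ?_ ⟨σ a, ?_, hadj⟩ ?_ ?_ ?_ ⟨σ b, ?_, hbdj⟩ ?_
  · intro v; simp only [mem_initialSet]; omega
  · simp only [mem_initialSet, Equiv.symm_apply_apply]; omega
  · simp only [mem_initialSet, Equiv.symm_apply_apply]; omega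
  · intro v; simp only [mem_initialSet]; omega
  · simpa using hj
  · simpa using hb
  · simp

/-- The payment for the labelling `σ`, read as a sequence of draws from `H` itself, after its first `i`
vertices. -/
abbrev selfReward (σ : Fin k ≃ V) (H : SimpleGraph V) (i : ℕ) : ℝ :=
  reward H (IsFull H H) (IsCritical H H) (initialSet σ i) ((List.ofFn σ).drop i)

/-- Between the indices `i` and `i'` the payment is not decided if every vertex that meets the earlier
ones leads to a set that is neither full nor critical. -/
lemma selfReward_eq {i i' : ℕ} (hi : i ≤ i') (hk : i' ≤ k)
    (h : ∀ j : Fin k, i ≤ j → (j : ℕ) < i' → H.IsBackAttached σ j →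
      ¬ IsFull H H (initialSet σ (j + 1)) ∧ ¬ IsCritical H H (initialSet σ (j + 1))) :
    selfReward σ H i = selfReward σ H i' := by
  induction i', hi using Nat.le_induction with
  | base => rfl
  | succ i' hi ih =>
    rw [ih (by omega) fun j hj hj' => h j hj (by omega)]
    have hd := drop_ofFn σ ⟨i', hk⟩
    have hins := insert_initialSet σ ⟨i', hk⟩
    simp only at hd hins
    rw [selfReward, hd, reward, hins]
    by_cases hB : H.IsBackAttached σ ⟨i', hk⟩
    · have h2 := h _ hi (Nat.lt_succ_self i') hB
      have h1 : H.Meets (initialSet σ i') (σ ⟨i', hk⟩) := isBackAttached_iff_meets.1 hB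
      simp only at h2
      simp only [h1, h2.1, h2.2, not_true, if_false]
    · have h1 : ¬ H.Meets (initialSet σ i') (σ ⟨i', hk⟩) :=
        fun h => hB (isBackAttached_iff_meets.2 h)
      simp only [h1, not_false_iff, if_true]

lemma selfReward_last {i : Fin k} (hB : H.IsBackAttached σ i)
    (hlast : ∀ j, i < j → ¬ H.IsBackAttached σ j) (hi : (i : ℕ) + 2 < k) :
    selfReward σ H i = Real.exp 1 := by
  have hgt : ∀ j : Fin k, (i : ℕ) + 1 ≤ j → ¬ H.IsBackAttached σ j := fun j hj => hlast j hj
  rw [selfReward, drop_ofFn, reward, insert_initialSet, if_neg (not_not.2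
    (isBackAttached_iff_meets.1 hB)), if_pos (isFull_initialSet hgt), if_pos]
  refine ⟨?_, quiet_drop hgt⟩
  rw [List.length_drop, List.length_ofFn]
  omega

lemma core_initialSet_last {i : Fin k} (hlast : ∀ j, i < j → ¬ H.IsBackAttached σ j) :
    H.core (initialSet σ i) = H.core {σ i}ᶜ := by
  refine (H.core_eq_of_subset (fun v hv => ?_) fun y hy hyX z _ => ?_).symm
  · rintro rfl; simp at hv
  · obtain ⟨j, rfl⟩ := σ.surjective y
    simp only [Finset.mem_coe, mem_initialSet, Equiv.symm_apply_apply, not_lt,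
      Set.mem_compl_iff, Set.mem_singleton_iff, EmbeddingLike.apply_eq_iff_eq] at hy hyX
    have hij : i < j := lt_of_le_of_ne hyX (Ne.symm hy)
    exact isIsolated_of_forall_not (fun j' hj' => hlast j' (hij.trans_le hj')) z

lemma core_initialSet_eq {i i' : ℕ} (hi : i ≤ i')
    (h : ∀ j : Fin k, i ≤ j → (j : ℕ) < i' → ¬ H.IsBackAttached σ j) :
    H.core (initialSet σ i') = H.core (initialSet σ i) := by
  refine H.core_eq_of_subset (fun v hv => ?_) fun y hy hyX z hz hyz => ?_
  · simp only [Finset.mem_coe, mem_initialSet] at hv ⊢; omega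
  · obtain ⟨j, rfl⟩ := σ.surjective y
    obtain ⟨j', rfl⟩ := σ.surjective z
    simp only [Finset.mem_coe, mem_initialSet, Equiv.symm_apply_apply, not_lt] at hy hyX hz
    rcases lt_trichotomy j j' with hij | rfl | hij
    · exact h j' (by omega) hz (isBackAttached_iff_exists.2 ⟨j, hij, hyz⟩)
    · exact H.irrefl hyz
    · exact h j hyX hy (isBackAttached_iff_exists.2 ⟨j', hij, hyz.symm⟩)

section LastTwo

variable {i₁ i₂ : Fin k}

lemma core_erase_initialSet (h : H.IsLastTwo σ i₁ i₂) :
    H.core ((initialSet σ i₂).erase (σ i₁) : Finset V) = H.core (initialSet σ i₁) := by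
  have hlt := h.lt
  refine H.core_eq_of_subset (fun v hv => ?_) fun y hy hyX z hz hyz => ?_
  · simp only [Finset.coe_erase, Set.mem_sdiff, Finset.mem_coe, mem_initialSet,
      Set.mem_singleton_iff] at hv ⊢
    refine ⟨by omega, ?_⟩
    rintro rfl
    simp at hv
  · obtain ⟨j, rfl⟩ := σ.surjective y
    obtain ⟨j', rfl⟩ := σ.surjective z
    simp only [Finset.coe_erase, Set.mem_sdiff, Finset.mem_coe, mem_initialSet,
      Set.mem_singleton_iff, Equiv.symm_apply_apply, not_lt,
      EmbeddingLike.apply_eq_iff_eq] at hy hyX hz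
    rcases lt_trichotomy j j' with hij | rfl | hij
    · have := h.last j' (isBackAttached_iff_exists.2 ⟨j, hij, hyz⟩)
      omega
    · exact H.irrefl hyz
    · have := h.last j (isBackAttached_iff_exists.2 ⟨j', hij, hyz.symm⟩)
      omega

lemma core_erase_initialSet_succ (h : H.IsLastTwo σ i₁ i₂) :
    H.core ((initialSet σ (i₂ + 1)).erase (σ i₁) : Finset V) = H.core {σ i₁}ᶜ := by
  have hlt := h.lt
  refine (H.core_eq_of_subset (fun v hv => ?_) fun y hy hyX z _ => ?_).symm
  · simp only [Finset.coe_erase, Set.mem_sdiff] at hv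
    exact hv.2
  · obtain ⟨j, rfl⟩ := σ.surjective y
    simp only [Finset.coe_erase, Set.mem_sdiff, Finset.mem_coe, mem_initialSet,
      Set.mem_singleton_iff, Equiv.symm_apply_apply, Set.mem_compl_iff,
      EmbeddingLike.apply_eq_iff_eq, not_and, not_not] at hy hyX
    refine isIsolated_of_forall_not (fun j' hj' hB => ?_) z
    have := h.last j' hB
    by_cases hj : (j : ℕ) < i₂ + 1
    · exact hy (hyX hj)
    · omega

lemma pairReward_eq (h : H.IsLastTwo σ i₁ i₂) {i : ℕ} (hi : (i₁ : ℕ) + 1 ≤ i) (hi' : i ≤ i₂) :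
    pairReward H (IsFull H H) (IsCritical H H) true (σ i₁) (initialSet σ i₁)
      ((List.ofFn σ).drop (i₁ + 1)) =
    pairReward H (IsFull H H) (IsCritical H H) (decide (i = i₁ + 1)) (σ i₁)
      ((initialSet σ i).erase (σ i₁)) ((List.ofFn σ).drop i) := by
  induction i, hi using Nat.le_induction with
  | base =>
    rw [← insert_initialSet, Finset.erase_insert (by simp)]
    simp
  | succ i hi ih =>
    have hik : i < k := by omega
    rw [ih (by omega)]
    have hd := drop_ofFn σ ⟨i, hik⟩
    have hins := insert_initialSet σ ⟨i, hik⟩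
    simp only at hd hins
    have hne : σ ⟨i, hik⟩ ≠ σ i₁ := by
      rw [Ne, EmbeddingLike.apply_eq_iff_eq, Fin.ext_iff]
      simp only; omega
    have hB : ¬ H.IsBackAttached σ ⟨i, hik⟩ := fun hB => by
      have := h.last _ hB
      simp only [Fin.le_def, Fin.ext_iff] at this
      omega
    have hm : ¬ H.Meets (initialSet σ i) (σ ⟨i, hik⟩) := fun hm => hB (isBackAttached_iff_meets.2 hm)
    rw [hd, pairReward, Finset.insert_erase (by simpa using hi), if_pos hm,
      ← Finset.erase_insert_of_ne hne, hins]
    congr 1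
    simp; omega

lemma selfReward_eq_last_two (h : H.IsLastTwo σ i₁ i₂) : selfReward σ H 0 = selfReward σ H i₁ :=
  selfReward_eq (Nat.zero_le _) i₁.2.le fun _ _ hj _ =>
    ⟨not_isFull_initialSet hj h.left, not_isCritical_initialSet hj h.lt h.left h.right⟩

lemma selfReward_last_two (h : H.IsLastTwo σ i₁ i₂) : selfReward σ H i₁ =
    if IsCritical H H (initialSet σ (i₁ + 1)) then
      if H.Meets ((initialSet σ i₂).erase (σ i₁)) (σ i₂) ∧
          IsCritical H H ((initialSet σ (i₂ + 1)).erase (σ i₁)) then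
        if (i₂ : ℕ) ≠ i₁ + 1 ∧ (i₂ : ℕ) + 1 < k then Real.exp 1 ^ 2 / 2 else 0
      else if (i₂ : ℕ) + 2 < k then Real.exp 1 else 0
    else selfReward σ H (i₁ + 1) := by
  have hlt := h.lt
  have hgt : ∀ j : Fin k, (i₂ : ℕ) + 1 ≤ j → ¬ H.IsBackAttached σ j := fun j hj hB => by
    have := h.last j hB
    omega
  have hne : σ i₂ ≠ σ i₁ := by
    rw [Ne, EmbeddingLike.apply_eq_iff_eq]; exact h.lt.ne'
  rw [selfReward, drop_ofFn, reward, insert_initialSet, if_neg (not_not.2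
    (isBackAttached_iff_meets.1 h.left)), if_neg (not_isFull_initialSet (Nat.succ_le_of_lt h.lt) h.right)]
  congr 1
  rw [pairReward_eq h (Nat.succ_le_of_lt h.lt) le_rfl, drop_ofFn, pairReward,
    Finset.insert_erase (by simpa using h.lt), if_neg (not_not.2 (isBackAttached_iff_meets.1 h.right)),
    ← Finset.erase_insert_of_ne hne, insert_initialSet, if_neg]
  · have hq := quiet_drop hgt
    simp only [hq, and_true, List.length_drop, List.length_ofFn]
    congr 2
    · simp; omega
    · simp; omega
  · rw [not_or, not_not]
    exact ⟨isFull_initialSet hgt, not_isFull_of_notMem h.left.not_isIsolated (by simp)⟩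

lemma isCritical_initialSet_iff (h : H.IsLastTwo σ i₁ i₂) :
    IsCritical H H (initialSet σ (i₁ + 1)) ↔ H.IsDetectable (σ i₂) := by
  have hlt := h.lt
  refine isCritical_iff_isDetectable h.right.not_isIsolated ?_
  rw [← core_initialSet_last fun j hj hB => ?_, core_initialSet_eq (Nat.succ_le_of_lt h.lt)]
  · intro j hj hj' hB
    have := h.last j hB
    omega
  · have := h.last j hB
    omega

lemma isCritical_erase_iff (h : H.IsLastTwo σ i₁ i₂) :
    IsCritical H H ((initialSet σ (i₂ + 1)).erase (σ i₁)) ↔ H.IsDetectable (σ i₁) :=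
  isCritical_iff_isDetectable h.left.not_isIsolated (core_erase_initialSet_succ h)

/-- If `σ i₂` were attached only through `σ i₁`, then `M(H - σ i₁)` would be the core of the vertices
before `σ i₁`, although two more vertices attach themselves to them. -/
lemma meets_erase_of_isDetectable (h : H.IsLastTwo σ i₁ i₂) (hd : H.IsDetectable (σ i₁)) :
    H.Meets ((initialSet σ i₂).erase (σ i₁)) (σ i₂) := by
  by_contra hm
  have hne : σ i₂ ≠ σ i₁ := by
    rw [Ne, EmbeddingLike.apply_eq_iff_eq]; exact h.lt.ne'
  have h3 := (isCritical_erase_iff h).2 hd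
  rw [← insert_initialSet, Finset.erase_insert_of_ne hne] at h3
  have h4 := IsCritical.of_insert _ _ hm h3
  rw [IsCritical, core_erase_initialSet h] at h4
  exact not_isCritical_initialSet le_rfl h.lt h.left h.right h4

end LastTwo

lemma exp_one_le_half_sq : Real.exp 1 ≤ Real.exp 1 ^ 2 / 2 := by
  have := Real.add_one_le_exp (1 : ℝ)
  nlinarith [Real.exp_pos 1]

/-- A labelling that is not bright and ends with two isolated vertices is paid at least `e`. -/
theorem exp_one_le_reward (hE : ∃ a b, H.Adj a b) (hσ : ¬ H.IsBright σ)
    (hiso : ∀ i : Fin k, k ≤ i + 2 → H.IsIsolated (σ i)) :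
    Real.exp 1 ≤ selfReward σ H 0 := by
  have hlarge : ∀ {i : Fin k}, H.IsBackAttached σ i → (i : ℕ) + 2 < k := fun {i} hi => by
    by_contra h
    exact hi.not_isIsolated (hiso i (by omega))
  set S : Finset (Fin k) := Finset.univ.filter fun i => H.IsBackAttached σ i with hS
  have hne : S.Nonempty := by
    by_contra hempty
    rw [Finset.not_nonempty_iff_eq_empty, Finset.filter_eq_empty_iff] at hempty
    obtain ⟨a, b, hab⟩ := hE
    have := isIsolated_of_forall_not (σ := σ) (i := σ.symm a) fun j _ => hempty (Finset.mem_univ j)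
    rw [Equiv.apply_symm_apply] at this
    exact this b hab
  set i₂ := S.max' hne with hi₂
  have h₂ : H.IsBackAttached σ i₂ := (Finset.mem_filter.1 (S.max'_mem hne)).2
  have hmax : ∀ j, i₂ < j → ¬ H.IsBackAttached σ j := fun j hj hB =>
    absurd (S.le_max' j (Finset.mem_filter.2 ⟨Finset.mem_univ _, hB⟩)) (not_le.2 hj)
  by_cases hne' : (S.erase i₂).Nonempty
  · set i₁ := (S.erase i₂).max' hne' with hi₁
    have hmem := (S.erase i₂).max'_mem hne'
    rw [← hi₁, Finset.mem_erase, Finset.mem_filter] at hmem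
    have h₁ : H.IsBackAttached σ i₁ := hmem.2.2
    have hlt : i₁ < i₂ := lt_of_le_of_ne (not_lt.1 fun h => hmax _ h h₁) hmem.1
    have hlast : ∀ j, H.IsBackAttached σ j → j ≤ i₁ ∨ j = i₂ := fun j hB => by
      by_cases hj : j = i₂
      · exact Or.inr hj
      · exact Or.inl ((S.erase i₂).le_max' j (Finset.mem_erase.2 ⟨hj,
          Finset.mem_filter.2 ⟨Finset.mem_univ _, hB⟩⟩))
    have h : H.IsLastTwo σ i₁ i₂ := ⟨hlt, h₁, h₂, hlast⟩
    rw [isBright_iff_last_two h, ← isCritical_erase_iff h,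
      ← isCritical_initialSet_iff h, and_comm] at hσ
    rw [selfReward_eq_last_two h, selfReward_last_two h]
    split_ifs with hc1 hc2 hc3 hc4
    · exact exp_one_le_half_sq
    · exact (hσ ⟨hc1, hc2.2⟩).elim
    · exact le_rfl
    · exact (hc4 (hlarge h₂)).elim
    · rw [selfReward_eq (Nat.succ_le_of_lt hlt) i₂.2.le, selfReward_last h₂ hmax (hlarge h₂)]
      intro j hj hj' hB
      have := hlast j hB
      omega
  · rw [Finset.not_nonempty_iff_eq_empty] at hne'
    have honly : ∀ j, H.IsBackAttached σ j → j = i₂ := fun j hB => by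
      by_contra hj
      have : j ∈ S.erase i₂ := Finset.mem_erase.2 ⟨hj, Finset.mem_filter.2 ⟨Finset.mem_univ _, hB⟩⟩
      rw [hne'] at this
      simp at this
    rw [selfReward_eq (Nat.zero_le _) i₂.2.le, selfReward_last h₂ hmax (hlarge h₂)]
    intro j _ hj' hB
    have := honly j hB
    omega

/-- A bright labelling is paid at least `e ^ 2 / 2` if its last two back-attached indices are not
consecutive and some vertex follows them. -/
theorem half_sq_le_reward {i₁ i₂ : Fin k} (h : H.IsLastTwo σ i₁ i₂)
    (hd₁ : H.IsDetectable (σ i₁)) (hd₂ : H.IsDetectable (σ i₂)) (hgap : (i₂ : ℕ) ≠ i₁ + 1)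
    (hk : (i₂ : ℕ) + 1 < k) : Real.exp 1 ^ 2 / 2 ≤ selfReward σ H 0 := by
  rw [selfReward_eq_last_two h, selfReward_last_two h,
    if_pos ((isCritical_initialSet_iff h).2 hd₂), if_pos
      ⟨meets_erase_of_isDetectable h hd₁, (isCritical_erase_iff h).2 hd₁⟩, if_pos ⟨hgap, hk⟩]

end Labelling

/-! ### Counting labellings -/

section Counting

open scoped Classical

variable {V : Type*} [Fintype V] {H : SimpleGraph V} {k : ℕ}

/-- By symmetry, each position of a uniformly random labelling carries a non-isolated vertex with
probability `m(H) / k`. -/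
lemma card_filter_not_isIsolated (e : Fin k ≃ V) (i : Fin k) :
    k * (Finset.univ.filter fun σ : Fin k ≃ V => ¬ H.IsIsolated (σ i)).card =
      k.factorial * H.numNonIsolated := by
  set c : Fin k → ℕ := fun i =>
    (Finset.univ.filter fun σ : Fin k ≃ V => ¬ H.IsIsolated (σ i)).card with hc
  have hconst : ∀ j, c j = c i := by
    intro j
    refine Finset.card_equiv ((Equiv.swap i j).equivCongr (Equiv.refl V)) fun σ => ?_
    simp [Equiv.equivCongr]
  have hsum : ∑ j, c j = k.factorial * H.numNonIsolated := by
    simp only [hc, Finset.card_filter]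
    rw [Finset.sum_comm]
    have : ∀ σ : Fin k ≃ V, ∑ j, (if ¬ H.IsIsolated (σ j) then 1 else 0) = H.numNonIsolated := by
      intro σ
      rw [σ.sum_comp fun v => if ¬ H.IsIsolated v then 1 else 0, ← Finset.card_filter,
        numNonIsolated, Set.ncard_eq_toFinset_card']
      congr 1
      ext v; simp
    rw [Finset.sum_congr rfl fun σ _ => this σ, Finset.sum_const, Finset.card_univ,
      Fintype.card_equiv e, Fintype.card_fin, smul_eq_mul]
  rw [← hsum, Finset.sum_congr rfl fun j _ => hconst j]
  simp [hc]

lemma card_filter_exists_not_isIsolated_le (e : Fin k ≃ V) {α : ℝ} (hα : 0 ≤ α)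
    (hm : (H.numNonIsolated : ℝ) ≤ α * k) :
    ((Finset.univ.filter fun σ : Fin k ≃ V =>
      ∃ i : Fin k, k ≤ i + 2 ∧ ¬ H.IsIsolated (σ i)).card : ℝ) ≤ 2 * α * k.factorial := by
  have hone : ∀ i : Fin k, ((Finset.univ.filter fun σ : Fin k ≃ V =>
      ¬ H.IsIsolated (σ i)).card : ℝ) ≤ α * k.factorial := by
    intro i
    have hk : (0 : ℝ) < k := by exact_mod_cast i.pos
    have h : (k : ℝ) * ((Finset.univ.filter fun σ : Fin k ≃ V =>
      ¬ H.IsIsolated (σ i)).card : ℝ) = k.factorial * H.numNonIsolated := by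
      exact_mod_cast card_filter_not_isIsolated e i
    refine le_of_mul_le_mul_left ?_ hk
    rw [h]
    have := mul_le_mul_of_nonneg_left hm (Nat.cast_nonneg k.factorial)
    linarith
  set T : Finset (Fin k) := Finset.univ.filter fun i => k ≤ (i : ℕ) + 2 with hT
  have hTcard : T.card ≤ 2 := by
    have h1 : T.map Fin.valEmbedding ⊆ Finset.Ico (k - 2) k := by
      intro a ha
      obtain ⟨i, hi, rfl⟩ := Finset.mem_map.1 ha
      have := (Finset.mem_filter.1 hi).2
      have := i.2
      simp only [Fin.valEmbedding_apply]
      rw [Finset.mem_Ico]; omega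
    have h2 := Finset.card_le_card h1
    rw [Finset.card_map, Nat.card_Ico] at h2
    omega
  have hsub : (Finset.univ.filter fun σ : Fin k ≃ V =>
      ∃ i : Fin k, k ≤ i + 2 ∧ ¬ H.IsIsolated (σ i)) ⊆
      T.biUnion fun i => Finset.univ.filter fun σ : Fin k ≃ V => ¬ H.IsIsolated (σ i) := by
    intro σ hσ
    obtain ⟨i, hi, h⟩ := (Finset.mem_filter.1 hσ).2
    exact Finset.mem_biUnion.2 ⟨i, by simp [hT, hi], by simp [h]⟩
  calc _ ≤ ((∑ i ∈ T, (Finset.univ.filter fun σ : Fin k ≃ V =>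
        ¬ H.IsIsolated (σ i)).card : ℕ) : ℝ) := by
        exact_mod_cast (Finset.card_le_card hsub).trans Finset.card_biUnion_le
    _ ≤ ∑ i ∈ T, α * k.factorial := by
        push_cast
        exact Finset.sum_le_sum fun i _ => hone i
    _ ≤ 2 * (α * k.factorial) := by
        rw [Finset.sum_const, nsmul_eq_mul]
        have : (T.card : ℝ) ≤ 2 := by exact_mod_cast hTcard
        gcongr
    _ = _ := by ring

/-- The bright labellings whose last two back-attached indices are not consecutive and do not include the
last position. -/
def IsSeparatedBright (H : SimpleGraph V) (σ : Fin k ≃ V) : Prop :=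
  ∃ i₁ i₂ : Fin k, H.IsLastTwo σ i₁ i₂ ∧ H.IsDetectable (σ i₁) ∧ H.IsDetectable (σ i₂) ∧
    (i₂ : ℕ) ≠ i₁ + 1 ∧ (i₂ : ℕ) + 1 < k

/-- Exchanging the vertex at position `a` with the next one, where all vertices after `a` are isolated,
moves the back-attached index `a` by one and leaves the others in place. -/
lemma isBackAttached_swap_iff {σ : Fin k ≃ V} {a b : Fin k} (hab : (b : ℕ) = a + 1)
    (hiso : ∀ j, b ≤ j → H.IsIsolated (σ j)) (j : Fin k) :
    H.IsBackAttached ((Equiv.swap a b).trans σ) j ↔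
      (j < a ∧ H.IsBackAttached σ j) ∨ (j = b ∧ H.IsBackAttached σ a) := by
  have hadj : ∀ x y, H.Adj (σ x) (σ y) → x < b ∧ y < b := fun x y h =>
    ⟨not_le.1 fun hx => hiso x hx _ h, not_le.1 fun hy => hiso y hy _ h.symm⟩
  have hne : a ≠ b := fun h => by rw [h] at hab; omega
  simp only [isBackAttached_iff_exists, Equiv.trans_apply]
  constructor
  · rintro ⟨x, hx, h⟩
    have h' := hadj _ _ h
    have hxa : x ≠ a := by rintro rfl; simp at h'
    have hja : j ≠ a := by rintro rfl; simp at h'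
    by_cases hjb : j = b
    · subst hjb
      rw [Equiv.swap_apply_right, Equiv.swap_apply_of_ne_of_ne hxa hx.ne] at h
      exact Or.inr ⟨rfl, x, by omega, h⟩
    · have hxb : x ≠ b := by
        rintro rfl
        rw [Equiv.swap_apply_of_ne_of_ne hja hjb] at h'
        omega
      rw [Equiv.swap_apply_of_ne_of_ne hja hjb, Equiv.swap_apply_of_ne_of_ne hxa hxb] at h h'
      exact Or.inl ⟨by omega, x, hx, h⟩
  · rintro (⟨hj, x, hx, h⟩ | ⟨rfl, x, hx, h⟩)
    · refine ⟨x, hx, ?_⟩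
      rwa [Equiv.swap_apply_of_ne_of_ne hj.ne (by omega),
        Equiv.swap_apply_of_ne_of_ne (hx.trans hj).ne (by omega)]
    · refine ⟨x, by omega, ?_⟩
      rwa [Equiv.swap_apply_right, Equiv.swap_apply_of_ne_of_ne hx.ne (by omega)]

/-- Exchanging the last back-attached vertex with its isolated successor maps the bright labellings that
end with two isolated vertices injectively to the separated ones. -/
lemma card_bright_le : (Finset.univ.filter fun σ : Fin k ≃ V => H.IsBright σ).card ≤
    (Finset.univ.filter fun σ : Fin k ≃ V => H.IsSeparatedBright σ).card +
    (Finset.univ.filter fun σ : Fin k ≃ V =>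
      ∃ i : Fin k, k ≤ i + 2 ∧ ¬ H.IsIsolated (σ i)).card := by
  -- `a` is the last back-attached index of `σ`, and `b` the position after it
  have hex : ∀ σ : Fin k ≃ V, H.IsBright σ → (∀ i : Fin k, k ≤ i + 2 → H.IsIsolated (σ i)) →
      ∃ a b : Fin k, (b : ℕ) = a + 1 ∧ H.IsSeparatedBright ((Equiv.swap a b).trans σ) ∧
        H.IsBackAttached ((Equiv.swap a b).trans σ) b ∧
        ∀ j, H.IsBackAttached ((Equiv.swap a b).trans σ) j → j ≤ b := by
    rintro σ ⟨i₁, i₂, hlt, h₁, h₂, hlast, hd₁, hd₂⟩ hiso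
    have hk : (i₂ : ℕ) + 2 < k := by
      by_contra h
      exact h₂.not_isIsolated (hiso i₂ (by omega))
    have hb : ((⟨i₂ + 1, by omega⟩ : Fin k) : ℕ) = i₂ + 1 := rfl
    set b : Fin k := ⟨i₂ + 1, by omega⟩ with hb'
    have hswap := isBackAttached_swap_iff hb fun j hj => isIsolated_of_forall_not fun j' hj' hB => by
      have := hlast j' hB
      omega
    refine ⟨i₂, b, hb, ⟨i₁, b, ⟨by omega, ?_, ?_, ?_⟩, ?_, ?_, by omega, by omega⟩,
      (hswap b).2 (Or.inr ⟨rfl, h₂⟩), ?_⟩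
    · exact (hswap i₁).2 (Or.inl ⟨hlt, h₁⟩)
    · exact (hswap b).2 (Or.inr ⟨rfl, h₂⟩)
    · intro j hj
      rcases (hswap j).1 hj with ⟨hj', hB⟩ | ⟨hj', -⟩
      · have := hlast j hB
        omega
      · exact Or.inr hj'
    · rwa [Equiv.trans_apply, Equiv.swap_apply_of_ne_of_ne hlt.ne (by omega)]
    · rwa [Equiv.trans_apply, Equiv.swap_apply_right]
    · intro j hj
      rcases (hswap j).1 hj with ⟨hj', hB⟩ | ⟨hj', -⟩ <;> omega
  rw [← Finset.card_filter_add_card_filter_not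
    (s := Finset.univ.filter fun σ : Fin k ≃ V => H.IsBright σ)
    (fun σ => ∀ i : Fin k, k ≤ i + 2 → H.IsIsolated (σ i))]
  refine Nat.add_le_add ?_ (Finset.card_le_card fun σ hσ => ?_)
  · rw [Finset.filter_filter, ← Fintype.card_subtype, ← Fintype.card_subtype]
    choose a b hab hsep hB hmax using
      fun σ : {σ : Fin k ≃ V // H.IsBright σ ∧ ∀ i : Fin k, k ≤ i + 2 → H.IsIsolated (σ i)} =>
        hex σ.1 σ.2.1 σ.2.2
    refine Fintype.card_le_of_injective (fun σ => ⟨_, hsep σ⟩) fun σ τ h => Subtype.ext ?_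
    have h' : (Equiv.swap (a σ) (b σ)).trans σ.1 = (Equiv.swap (a τ) (b τ)).trans τ.1 :=
      congrArg Subtype.val h
    have hb : b σ = b τ :=
      le_antisymm (hmax τ _ (h' ▸ hB σ)) (hmax σ _ (h'.symm ▸ hB τ))
    have ha : a σ = a τ := by
      have h1 := hab σ
      have h2 := hab τ
      omega
    rw [hb, ha] at h'
    ext x
    have hx := Equiv.congr_fun h' (Equiv.swap (a τ) (b τ) x)
    simpa using hx
  · simp only [Finset.mem_filter, Finset.mem_univ, true_and] at hσ ⊢
    simpa using hσ.2

end Counting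

/-! ### The bound on the inducibility -/

section Inducibility

open scoped Classical

variable {V : Type*} [Fintype V] {H : SimpleGraph V}

lemma sum_reward_ge {k : ℕ} (e : Fin k ≃ V) (hE : ∃ a b, H.Adj a b) {α : ℝ} (hα : 0 ≤ α)
    (hm : (H.numNonIsolated : ℝ) ≤ α * k) {ν : ℝ}
    (hν : ((Finset.univ.filter fun σ : Fin k ≃ V => H.IsBright σ).card : ℝ) = ν * k.factorial) :
    (Real.exp 1 * (1 - ν - 2 * α) + Real.exp 1 ^ 2 / 2 * (ν - 2 * α)) * k.factorial ≤
      ∑ σ : Fin k ≃ V, selfReward σ H 0 := by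
  set bad := Finset.univ.filter fun σ : Fin k ≃ V =>
    ∃ i : Fin k, k ≤ i + 2 ∧ ¬ H.IsIsolated (σ i) with hbad
  set A := Finset.univ.filter fun σ : Fin k ≃ V =>
    ¬ H.IsBright σ ∧ ∀ i : Fin k, k ≤ i + 2 → H.IsIsolated (σ i) with hA
  set B := Finset.univ.filter fun σ : Fin k ≃ V => H.IsSeparatedBright σ with hB
  have hbadc := card_filter_exists_not_isIsolated_le e hα hm
  have hBc : ν * k.factorial ≤ (B.card : ℝ) + bad.card := by
    rw [← hν]; exact_mod_cast card_bright_le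
  have hAc : (k.factorial : ℝ) ≤ A.card + ν * k.factorial + bad.card := by
    rw [← hν]
    have h : (Finset.univ : Finset (Fin k ≃ V)) ⊆
        A ∪ (Finset.univ.filter fun σ : Fin k ≃ V => H.IsBright σ) ∪ bad := by
      intro σ _
      by_cases h1 : H.IsBright σ
      · simp [h1]
      · by_cases h2 : ∀ i : Fin k, k ≤ i + 2 → H.IsIsolated (σ i)
        · exact Finset.mem_union_left _ (Finset.mem_union_left _ (Finset.mem_filter.2 ⟨Finset.mem_univ _, h1, h2⟩))
        · exact Finset.mem_union_right _ (by simpa [hbad] using h2)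
    have h2 := (Finset.card_le_card h).trans
      ((Finset.card_union_le _ _).trans (Nat.add_le_add_right (Finset.card_union_le _ _) _))
    rw [Finset.card_univ, Fintype.card_equiv e, Fintype.card_fin] at h2
    exact_mod_cast h2
  have hdisj : Disjoint A B := by
    rw [Finset.disjoint_left]
    intro σ h1 h2
    obtain ⟨i₁, i₂, h3, h4, h5, -⟩ := (Finset.mem_filter.1 h2).2
    exact (Finset.mem_filter.1 h1).2.1 ⟨i₁, i₂, h3.lt, h3.left, h3.right, h3.last, h4, h5⟩
  have he := Real.exp_pos 1
  calc _ ≤ (A.card : ℝ) * Real.exp 1 + B.card * (Real.exp 1 ^ 2 / 2) := by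
        have h1 : (1 - ν - 2 * α) * k.factorial ≤ (A.card : ℝ) := by linarith
        have h2 : (ν - 2 * α) * k.factorial ≤ (B.card : ℝ) := by linarith
        have h3 := mul_le_mul_of_nonneg_left h1 he.le
        have h4 := mul_le_mul_of_nonneg_left h2 (by positivity : 0 ≤ Real.exp 1 ^ 2 / 2)
        linarith
    _ ≤ ∑ σ ∈ A, selfReward σ H 0 + ∑ σ ∈ B, selfReward σ H 0 := by
        rw [← nsmul_eq_mul, ← nsmul_eq_mul]
        refine add_le_add (Finset.card_nsmul_le_sum _ _ _ fun σ hσ => ?_)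
          (Finset.card_nsmul_le_sum _ _ _ fun σ hσ => ?_)
        · have h := (Finset.mem_filter.1 hσ).2
          exact exp_one_le_reward hE h.1 h.2
        · obtain ⟨i₁, i₂, h3, h4, h5, h6, h7⟩ := (Finset.mem_filter.1 hσ).2
          exact half_sq_le_reward h3 h4 h5 h6 h7
    _ = ∑ σ ∈ A ∪ B, selfReward σ H 0 := (Finset.sum_union hdisj).symm
    _ ≤ _ := Finset.sum_le_univ_sum_of_nonneg fun σ => reward_nonneg _ _ _ _ _

/-- An induced copy of `H` on `W` and a labelling of `H` determine a sequence of vertices of `G`, and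
different pairs determine different sequences. -/
lemma inducedCount_mul_sum_le {U : Type*} [Fintype U] (G : SimpleGraph U) :
    (inducedCount H G : ℝ) * ∑ σ : Fin (Fintype.card V) ≃ V, selfReward σ H 0 ≤
      ∑ f : Fin (Fintype.card V) → U,
        reward G (IsFull H G) (IsCritical H G) ∅ (List.ofFn f) := by
  set S := {W : Finset U // W.card = Fintype.card V ∧ Nonempty (G.induce (W : Set U) ≃g H)} with hS
  let ψ : S → (H ↪g G) := fun W =>
    (Embedding.induce (G := G) (W.1 : Set U)).comp W.2.2.some.symm.toEmbedding
  have hψ : ∀ W : S, Set.range (ψ W) = (W.1 : Set U) := by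
    intro W
    ext u
    constructor
    · rintro ⟨v, rfl⟩
      exact (W.2.2.some.symm v).2
    · intro hu
      refine ⟨W.2.2.some ⟨u, hu⟩, ?_⟩
      change ((W.2.2.some.symm (W.2.2.some ⟨u, hu⟩) : (W.1 : Set U)) : U) = u
      rw [RelIso.symm_apply_apply]
  let F : S × (Fin (Fintype.card V) ≃ V) → (Fin (Fintype.card V) → U) := fun p => ψ p.1 ∘ p.2
  have hF : Function.Injective F := by
    rintro ⟨W, σ⟩ ⟨W', σ'⟩ h
    have hr : ∀ p, Set.range (F p) = (p.1.1 : Set U) := fun p => by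
      rw [← hψ p.1]; exact p.2.surjective.range_comp _
    have hW : W = W' := Subtype.ext (Finset.coe_injective (by
      rw [← hr (W, σ), ← hr (W', σ'), h]))
    subst hW
    have hσ : σ = σ' := Equiv.ext fun i => (ψ W).injective (congrFun h i)
    rw [hσ]
  have hreward : ∀ p, reward G (IsFull H G) (IsCritical H G) ∅ (List.ofFn (F p)) =
      selfReward p.2 H 0 := by
    intro p
    have h := reward_map (ψ p.1) (List.ofFn p.2) ∅
    rw [Finset.map_empty, List.map_ofFn] at h
    rw [selfReward, initialSet_zero, List.drop_zero, ← h]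
  calc (inducedCount H G : ℝ) * ∑ σ : Fin (Fintype.card V) ≃ V, selfReward σ H 0
      = ∑ p : S × (Fin (Fintype.card V) ≃ V), selfReward p.2 H 0 := by
        simp only [Fintype.sum_prod_type]
        rw [Finset.sum_const, nsmul_eq_mul, inducedCount, Nat.card_eq_fintype_card,
          Finset.card_univ]
    _ = ∑ f ∈ Finset.univ.map ⟨F, hF⟩,
          reward G (IsFull H G) (IsCritical H G) ∅ (List.ofFn f) := by
        rw [Finset.sum_map]
        exact Finset.sum_congr rfl fun p _ => (hreward p).symm
    _ ≤ _ := Finset.sum_le_univ_sum_of_nonneg fun f => reward_nonneg _ _ _ _ _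

lemma sum_reward_le {U : Type*} [Fintype U] [Nonempty U] (G : SimpleGraph U)
    (hE : 2 ≤ H.edgeSet.ncard) :
    ∑ f : Fin (Fintype.card V) → U, reward G (IsFull H G) (IsCritical H G) ∅ (List.ofFn f) ≤
      (Fintype.card U : ℝ) ^ Fintype.card V := by
  obtain ⟨a, b, hab⟩ := H.exists_adj_of_two_le hE
  have hk : 2 ≤ Fintype.card V := Fintype.one_lt_card_iff.2 ⟨a, b, hab.ne⟩
  obtain ⟨q, hq⟩ := Nat.exists_eq_add_of_le' hk
  have h := rewardMean_le_one G (IsFull H G) (IsCritical H G) IsFull.of_insert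
    IsCritical.of_insert (not_isFull_empty H G hE) (not_isCritical_empty H G hE) q
  rw [← hq, rewardMean, mean_eq_sum, div_le_one (by positivity)] at h
  exact h

/-- Averaged over the labellings, each induced copy of `H` is paid at least
`e * (1 - ν - 2 * α) + e ^ 2 / 2 * (ν - 2 * α)`. -/
lemma inducibility_mul_le (hE : 2 ≤ H.edgeSet.ncard) {α : ℝ} (hα : 0 ≤ α)
    (hm : (H.numNonIsolated : ℝ) ≤ α * (Fintype.card V : ℝ)) :
    H.inducibility * (Real.exp 1 * (1 - H.brightness - 2 * α)
      + Real.exp 1 ^ 2 / 2 * (H.brightness - 2 * α)) ≤ 1 := by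
  set k := Fintype.card V with hk
  set C := Real.exp 1 * (1 - H.brightness - 2 * α)
      + Real.exp 1 ^ 2 / 2 * (H.brightness - 2 * α) with hC
  have hfac : (0 : ℝ) < k.factorial := by exact_mod_cast k.factorial_pos
  have hν : ((Finset.univ.filter fun σ : Fin k ≃ V => H.IsBright σ).card : ℝ) =
      H.brightness * k.factorial := by
    rw [brightness, Nat.card_eq_fintype_card, Nat.card_eq_fintype_card,
      Fintype.card_equiv (Fintype.equivFin V).symm, Fintype.card_fin,
      div_mul_cancel₀ _ hfac.ne', Fintype.card_subtype]
  have hsum := sum_reward_ge (Fintype.equivFin V).symm (H.exists_adj_of_two_le hE) hα hm hν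
  have hlim := (isEquivalent_choose k)
  have hbound : ∀ᶠ n in atTop, maxInducedDensity H n * C * ((n.choose k : ℝ) /
      ((n : ℝ) ^ k / k.factorial)) ≤ 1 := by
    filter_upwards [eventually_ge_atTop (k + 1)] with n hn
    have : Nonempty (Fin n) := ⟨⟨0, by omega⟩⟩
    obtain ⟨G, hG⟩ := exists_eq_ciSup_of_finite (f := fun G : SimpleGraph (Fin n) =>
      inducedDensity H G)
    have hch : (0 : ℝ) < (n.choose k : ℝ) := by exact_mod_cast Nat.choose_pos (by omega)
    have hn0 : (0 : ℝ) < (n : ℝ) := by exact_mod_cast (by omega : 0 < n)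
    have h1 := (inducedCount_mul_sum_le (H := H) G).trans (sum_reward_le G hE)
    have h2 := (mul_le_mul_of_nonneg_left hsum (Nat.cast_nonneg (inducedCount H G))).trans h1
    rw [Fintype.card_fin] at h2
    rw [maxInducedDensity, ← hG, inducedDensity, Fintype.card_fin, ← hk]
    have h3 : (inducedCount H G : ℝ) / (n.choose k : ℝ) * C * ((n.choose k : ℝ) /
      ((n : ℝ) ^ k / k.factorial)) = (inducedCount H G : ℝ) * (C * k.factorial) / (n : ℝ) ^ k := by
      field_simp
    rw [h3, div_le_one (by positivity)]
    exact h2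
  have hone : Tendsto (fun n : ℕ => (n.choose k : ℝ) / ((n : ℝ) ^ k / k.factorial)) atTop (𝓝 1) := by
    refine (Asymptotics.isEquivalent_iff_tendsto_one ?_).1 hlim
    filter_upwards [eventually_ge_atTop 1] with n hn
    have hn0 : (0 : ℝ) < (n : ℝ) := by exact_mod_cast hn
    positivity
  have ht := ((tendsto_inducibility H).mul_const C).mul hone
  rw [mul_one] at ht
  exact le_of_tendsto ht hbound

lemma inducedDensity_le_one {U : Type*} [Fintype U] (G : SimpleGraph U) :
    inducedDensity H G ≤ 1 := by
  refine div_le_one_of_le₀ ?_ (Nat.cast_nonneg _)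
  have h := Nat.card_le_card_of_injective
    (fun W : {W : Finset U // W.card = Fintype.card V ∧ Nonempty (G.induce (W : Set U) ≃g H)} =>
      (⟨W.1, W.2.1⟩ : {s : Finset U // s.card = Fintype.card V}))
    fun W W' h => Subtype.ext (Subtype.mk.inj h)
  rw [Nat.card_eq_fintype_card (α := {s : Finset U // s.card = Fintype.card V}),
    Fintype.card_finset_len] at h
  exact_mod_cast h

lemma inducibility_le_one : H.inducibility ≤ 1 :=
  le_of_tendsto' (tendsto_inducibility H) fun _ => ciSup_le fun G => inducedDensity_le_one G

lemma brightness_nonneg : 0 ≤ H.brightness := by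
  unfold brightness; positivity

end Inducibility

end SimpleGraph

end

theorem mainTheorem6 {V : Type*} [Fintype V] (α : ℝ) (hα : 0 < α) (k ℓ : ℕ) (hℓ : 2 ≤ ℓ)
    (H : SimpleGraph V) (hk : Fintype.card V = k) (hE : H.edgeSet.ncard = ℓ)
    (hm : (H.numNonIsolated : ℝ) ≤ α * (k : ℝ)) :
    H.inducibility ≤
      (2 + 3 * Real.exp 1 ^ 2 * α) / (2 + (Real.exp 1 - 2) * H.brightness) * (1 / Real.exp 1)
        + 2 * α := by
  subst hk hE
  have h1 := SimpleGraph.inducibility_mul_le hℓ hα.le hm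
  have h2 : H.inducibility ≤ 1 := SimpleGraph.inducibility_le_one
  have h3 : 0 ≤ H.brightness := SimpleGraph.brightness_nonneg
  have he : 2 ≤ Real.exp 1 := by
    have := Real.add_one_le_exp (1 : ℝ)
    linarith
  set e := Real.exp 1
  set ν := H.brightness
  set x := H.inducibility
  have hD : 2 ≤ 2 + (e - 2) * ν := by nlinarith
  -- the losses `2 * e * α` and `e ^ 2 * α` are charged at weight at most one
  have h4 : x * (2 * e * α + e ^ 2 * α) ≤ 2 * e * α + e ^ 2 * α :=
    mul_le_of_le_one_left (by positivity) h2
  have h5 : x * (e * (2 + (e - 2) * ν)) ≤ 2 + 3 * e ^ 2 * α + 4 * e * α := by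
    have : 0 ≤ e ^ 2 * α := by positivity
    nlinarith
  have h6 : 4 * e * α ≤ 2 * α * (e * (2 + (e - 2) * ν)) := by
    have : 0 ≤ e * α := by positivity
    nlinarith
  rw [div_mul_div_comm, mul_one, ← sub_le_iff_le_add, le_div_iff₀ (by positivity)]
  linarith
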